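/- For a function $f:\mathbb N\to\mathbb N$ with values in $\{0,\dots,k-1\}$ (written $f:\mathbb N\to k$), call $b\in\mathbb N$ a \emph{bound} for $f$ if for every $x\ge b$ there is $y>x$ with $f(x)=f(y)$. The principle $\mathsf{ECT}$ says that for every $k$, every $f:\mathbb N\to k$ has a bound. The principle $\mathsf{minECT}$ says that for every $k$, every $f:\mathbb N\to k$ has a least bound, i.e. a bound $b$ such that no $b'<b$ is a bound. A Weihrauch problem is a set $P\subseteq\mathbb N^{\mathbb N}\times\mathbb N$ of pairs (instance, solution), and $\operatorname{dom}(P)=\{I:\exists S\,(I,S)\in P\}$. We write $P\le_{\rm W}Q$ if there are (partial) computable functionals $\Phi$ and $\Psi$ such that for all $I\in\operatorname{dom}(P)$, $\Phi(I)$ is defined and $\Phi(I)\in\operatorname{dom}(Q)$, and for all $S$ with $(\Phi(I),S)\in Q$, $\Psi(I,S)$ is defined and $(I,\Psi(I,S))\in P$; and $P<_{\rm W}Q$ if $P\le_{\rm W}Q$ and $Q\not\le_{\rm W}P$. As Weihrauch problems, $\mathsf{ECT}$ and $\mathsf{minECT}$ both have as instances the pairs $(k,f)$ with $f:\mathbb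 N\to k$ (coded as the sequence $k,f(0),f(1),\dots$); the solutions of $\mathsf{ECT}$ are all bounds for $f$, and the solution of $\mathsf{minECT}$ is the least bound for $f$. $\mathsf{RCA}_0^*$ is the theory in the two-sorted language of second order arithmetic with exponentiation (symbols $0,1,+,\cdot,\exp,<,=,\in$) whose axioms are the basic arithmetic axioms, the axioms $m^0=1$ and $m^{n+1}=m^n\cdot m$, $\Sigma^0_0$ induction, and $\Delta^0_1$ comprehension. In it, functions are sets of pairs, with $(i,j)=(i+j)^2+i$. \textbf{Theorem.} $\mathsf{ECT}<_{\rm W}\mathsf{minECT}$. Nevertheless, $\mathsf{RCA}_0^*$ proves $\mathsf{ECT}\leftrightarrow\mathsf{minECT}$. -/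

import Mathlib

/-! ### Computable functionals and Weihrauch reducibility -/

/-- Partial computable functionals `F : ℕ^ℕ × ℕ ⇀ ℕ`, uniformly in the oracle `g : ℕ → ℕ`: the
least class of functionals that contains the basic functions and the oracle and is closed under
pairing, composition, primitive recursion and unbounded search (the clauses of `Nat.RecursiveIn`,
with one and the same derivation for all oracles). -/
inductive ComputableFunctional : ((ℕ → ℕ) → ℕ →. ℕ) → Prop
  | zero : ComputableFunctional fun _ _ => Part.some 0
  | succ : ComputableFunctional fun _ n => Part.some (n + 1)
  | left : ComputableFunctional fun _ n => Part.some n.unpair.1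
  | right : ComputableFunctional fun _ n => Part.some n.unpair.2
  | oracle : ComputableFunctional fun g n => Part.some (g n)
  | pair {F H : (ℕ → ℕ) → ℕ →. ℕ} (hF : ComputableFunctional F) (hH : ComputableFunctional H) :
      ComputableFunctional fun g n => Nat.pair <$> F g n <*> H g n
  | comp {F H : (ℕ → ℕ) → ℕ →. ℕ} (hF : ComputableFunctional F) (hH : ComputableFunctional H) :
      ComputableFunctional fun g n => H g n >>= F g
  | prec {F H : (ℕ → ℕ) → ℕ →. ℕ} (hF : ComputableFunctional F) (hH : ComputableFunctional H) :
      ComputableFunctional fun g p =>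
        p.unpair.2.rec (F g p.unpair.1) fun y IH => do
          let i ← IH
          H g (Nat.pair p.unpair.1 (Nat.pair y i))
  | rfind {F : (ℕ → ℕ) → ℕ →. ℕ} (hF : ComputableFunctional F) :
      ComputableFunctional fun g a =>
        Nat.rfind fun n => (fun m => decide (m = 0)) <$> F g (Nat.pair a n)

/-- A Weihrauch problem: a set of pairs (instance in `ℕ^ℕ`, solution in `ℕ`). -/
abbrev WProblem : Type := Set ((ℕ → ℕ) × ℕ)

/-- The instances of a problem: those that have a solution. -/
def WProblem.domain (P : WProblem) : Set (ℕ → ℕ) := {I | ∃ S, (I, S) ∈ P}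

/-- `P ≤_W Q`. There are partial computable functionals `Φ`, with values in `ℕ^ℕ`, and `Ψ`, with
values in `ℕ`, such that for every instance `I` of `P`, `Φ(I)` is (totally) defined and is an
instance of `Q`, and for every solution `S` of `Φ(I)`, `Ψ(I, S)` is defined and solves `I`. -/
def WeihrauchLE (P Q : WProblem) : Prop :=
  ∃ Φ Ψ : (ℕ → ℕ) → ℕ →. ℕ, ComputableFunctional Φ ∧ ComputableFunctional Ψ ∧
    ∀ I ∈ P.domain, ∃ J ∈ Q.domain, (∀ n, J n ∈ Φ I n) ∧
      ∀ S, (J, S) ∈ Q → ∃ R ∈ Ψ I S, (I, R) ∈ P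

/-- `P <_W Q`. -/
def WeihrauchLT (P Q : WProblem) : Prop := WeihrauchLE P Q ∧ ¬ WeihrauchLE Q P

/-- `b` is a bound for `f` as in ECT: every colour seen at some `x ≥ b` is seen again later. -/
def IsECTBound (f : ℕ → ℕ) (b : ℕ) : Prop := ∀ x, b ≤ x → ∃ y, x < y ∧ f x = f y

/-- `p ∈ ℕ^ℕ` codes the number `k = p 0` and the function `f = fun n => p (n + 1)`, which has to
take values `< k`. -/
def CodesColoring (p : ℕ → ℕ) : Prop := ∀ n, p (n + 1) < p 0

/-- ECT as a Weihrauch problem. -/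
def ECT : WProblem := {x | CodesColoring x.1 ∧ IsECTBound (fun n => x.1 (n + 1)) x.2}

/-- minECT as a Weihrauch problem: the solution is the least bound. -/
def minECT : WProblem :=
  {x | CodesColoring x.1 ∧ IsLeast {b | IsECTBound (fun n => x.1 (n + 1)) b} x.2}

/-! ### Second order arithmetic with exponentiation -/

namespace SOA

/-- Number terms of the two-sorted language `L₂(exp)`. Variables are de Bruijn indices. -/
inductive Term : Type
  | var : ℕ → Term
  | zero : Term
  | one : Term
  | add : Term → Term → Term
  | mul : Term → Term → Term
  | exp : Term → Term → Term

/-- Formulas of `L₂(exp)`. Number variables and set variables are two separate families of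
de Bruijn indices: `allN` binds number variable `0`, `allS` binds set variable `0`.
`mem t X` is `t ∈ X`. -/
inductive Formula : Type
  | eq : Term → Term → Formula
  | lt : Term → Term → Formula
  | mem : Term → ℕ → Formula
  | fal : Formula
  | imp : Formula → Formula → Formula
  | allN : Formula → Formula
  | allS : Formula → Formula

/-- Simultaneous substitution of terms for number variables. -/
def Term.subst (σ : ℕ → Term) : Term → Term
  | .var n => σ n
  | .zero => .zero
  | .one => .one
  | .add s t => .add (s.subst σ) (t.subst σ)
  | .mul s t => .mul (s.subst σ) (t.subst σ)
  | .exp s t => .exp (s.subst σ) (t.subst σ)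

/-- Raise all number variables by one. -/
def Term.shift (t : Term) : Term := t.subst fun n => .var (n + 1)

/-- A substitution for number variables, carried under a number quantifier. -/
def liftN (σ : ℕ → Term) : ℕ → Term
  | 0 => .var 0
  | n + 1 => (σ n).shift

/-- A renaming of set variables, carried under a set quantifier. -/
def liftS (ρ : ℕ → ℕ) : ℕ → ℕ
  | 0 => 0
  | n + 1 => ρ n + 1

namespace Formula

/-- Simultaneous capture-avoiding substitution of terms for number variables and of set variables
for set variables. -/
def subst : (ℕ → Term) → (ℕ → ℕ) → Formula → Formula
  | σ, _, eq s t => eq (s.subst σ) (t.subst σ)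
  | σ, _, lt s t => lt (s.subst σ) (t.subst σ)
  | σ, ρ, mem t X => mem (t.subst σ) (ρ X)
  | _, _, fal => fal
  | σ, ρ, imp φ ψ => imp (φ.subst σ ρ) (ψ.subst σ ρ)
  | σ, ρ, allN φ => allN (φ.subst (liftN σ) ρ)
  | σ, ρ, allS φ => allS (φ.subst σ (liftS ρ))

/-- Raise all free number variables by one. -/
def shiftN (φ : Formula) : Formula := φ.subst (fun n => .var (n + 1)) id

/-- Raise all free set variables by one. -/
def shiftS (φ : Formula) : Formula := φ.subst .var (· + 1)

/-- Substitute `t` for number variable `0`, lowering the others. -/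
def instN (φ : Formula) (t : Term) : Formula :=
  φ.subst (fun n => Nat.casesOn n t .var) id

/-- Substitute set variable `Y` for set variable `0`, lowering the others. -/
def instS (φ : Formula) (Y : ℕ) : Formula :=
  φ.subst .var fun n => Nat.casesOn n Y id

def neg (φ : Formula) : Formula := imp φ fal
def or (φ ψ : Formula) : Formula := imp (neg φ) ψ
def and (φ ψ : Formula) : Formula := neg (imp φ (neg ψ))
def iff (φ ψ : Formula) : Formula := and (imp φ ψ) (imp ψ φ)
def exN (φ : Formula) : Formula := neg (allN (neg φ))
def exS (φ : Formula) : Formula := neg (allS (neg φ))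
def le (s t : Term) : Formula := or (lt s t) (eq s t)

/-- `Σ⁰₀` formulas: all quantifiers are bounded number quantifiers `∀ n < t`, `∃ n < t`, where
`n` does not occur in `t`. -/
inductive IsSigma00 : Formula → Prop
  | eq (s t : Term) : IsSigma00 (eq s t)
  | lt (s t : Term) : IsSigma00 (lt s t)
  | mem (t : Term) (X : ℕ) : IsSigma00 (mem t X)
  | fal : IsSigma00 fal
  | imp {φ ψ : Formula} : IsSigma00 φ → IsSigma00 ψ → IsSigma00 (imp φ ψ)
  | ballN {φ : Formula} (t : Term) : IsSigma00 φ →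
      IsSigma00 (allN (Formula.imp (Formula.lt (.var 0) t.shift) φ))
  | bexN {φ : Formula} (t : Term) : IsSigma00 φ →
      IsSigma00 (exN (and (Formula.lt (.var 0) t.shift) φ))

end Formula

open Formula in
/-- Classical natural deduction for the two-sorted language, with equality of numbers.
`Derives T Γ φ`: `φ` is derivable from the axioms `T` under the hypotheses `Γ`. Axioms are read as
their universal closures, so the variable conditions of the two generalization rules concern
only `Γ`. -/
inductive Derives (T : Set Formula) : List Formula → Formula → Prop
  | ax {Γ φ} : φ ∈ T → Derives T Γ φ
  | hyp {Γ φ} : φ ∈ Γ → Derives T Γ φ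
  | impI {Γ φ ψ} : Derives T (φ :: Γ) ψ → Derives T Γ (imp φ ψ)
  | impE {Γ φ ψ} : Derives T Γ (imp φ ψ) → Derives T Γ φ → Derives T Γ ψ
  | raa {Γ φ} : Derives T (neg φ :: Γ) fal → Derives T Γ φ
  | allNI {Γ φ} : Derives T (Γ.map shiftN) φ → Derives T Γ (allN φ)
  | allNE {Γ : List Formula} {φ : Formula} (t : Term) : Derives T Γ (allN φ) → Derives T Γ (φ.instN t)
  | allSI {Γ φ} : Derives T (Γ.map shiftS) φ → Derives T Γ (allS φ)
  | allSE {Γ : List Formula} {φ : Formula} (Y : ℕ) : Derives T Γ (allS φ) → Derives T Γ (φ.instS Y)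
  | eqRefl {Γ} (t : Term) : Derives T Γ (eq t t)
  | eqSubst {Γ : List Formula} {φ : Formula} (s t : Term) :
      Derives T Γ (eq s t) → Derives T Γ (φ.instN s) → Derives T Γ (φ.instN t)

/-- The theory `T` proves `φ`. -/
def Proves (T : Set Formula) (φ : Formula) : Prop := Derives T [] φ

open Formula Term in
/-- The axioms of `RCA₀*`: basic axioms, exponentiation axioms, `Σ⁰₀` induction and `Δ⁰₁`
comprehension (free variables are parameters, i.e. universally quantified). -/
inductive RCA0starAxiom : Formula → Prop
  | succ_ne_zero : RCA0starAxiom (neg (eq (add (var 0) one) zero))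
  | succ_inj : RCA0starAxiom
      (imp (eq (add (var 0) one) (add (var 1) one)) (eq (var 0) (var 1)))
  | add_zero : RCA0starAxiom (eq (add (var 0) zero) (var 0))
  | add_succ : RCA0starAxiom
      (eq (add (var 0) (add (var 1) one)) (add (add (var 0) (var 1)) one))
  | mul_zero : RCA0starAxiom (eq (mul (var 0) zero) zero)
  | mul_succ : RCA0starAxiom
      (eq (mul (var 0) (add (var 1) one)) (add (mul (var 0) (var 1)) (var 0)))
  | not_lt_zero : RCA0starAxiom (neg (lt (var 0) zero))
  | lt_succ : RCA0starAxiom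
      (iff (lt (var 0) (add (var 1) one)) (or (lt (var 0) (var 1)) (eq (var 0) (var 1))))
  | exp_zero : RCA0starAxiom (eq (exp (var 0) zero) one)
  | exp_succ : RCA0starAxiom
      (eq (exp (var 0) (add (var 1) one)) (mul (exp (var 0) (var 1)) (var 0)))
  /-- `(φ(0) ∧ ∀ n (φ(n) → φ(n+1))) → ∀ n φ(n)`, for `φ` in `Σ⁰₀`. -/
  | sigma00_induction (φ : Formula) : IsSigma00 φ → RCA0starAxiom
      (imp
        (and (φ.instN zero)
          (allN (imp φ
            (φ.subst (fun n => Nat.casesOn n (add (var 0) one) fun m => var (m + 1)) id))))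
        (allN φ))
  /-- `∀ n (φ(n) ↔ ψ(n)) → ∃ X ∀ n (n ∈ X ↔ φ(n))`, for `φ = ∃ m θ` in `Σ⁰₁`, `ψ = ∀ m η` in
  `Π⁰₁`, with `X` not free in `φ`. -/
  | delta01_comprehension (θ η : Formula) : IsSigma00 θ → IsSigma00 η → RCA0starAxiom
      (imp (allN (iff (exN θ) (allN η)))
        (exS (allN (iff (mem (var 0) 0) (exN θ).shiftS))))

/-- The theory `RCA₀*`. -/
def RCA0star : Set Formula := {φ | RCA0starAxiom φ}

open Formula Term

/-- The code `(i, j) = (i + j)² + i` of a pair. -/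
def pair (i j : Term) : Term := add (mul (add i j) (add i j)) i

/-- `F : ℕ → k`, that is: every element of the set `F` is a pair `(i, j)` with `j < k`, and for
every `i` there is exactly one `j < k` with `(i, j) ∈ F`. Here `F` and `k` are a set variable and a
number variable. -/
def isFunction (F k : ℕ) : Formula :=
  and
    (allN (imp (mem (var 0) F)
      (exN (exN (and (lt (var 0) (var (k + 3))) (eq (var 2) (pair (var 1) (var 0))))))))
    (allN (exN (and (lt (var 0) (var (k + 2))) (and (mem (pair (var 1) (var 0)) F)
      (allN (imp (mem (pair (var 2) (var 0)) F) (eq (var 0) (var 1))))))))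

/-- `∀ x ≥ b ∃ y > x, F(x) = F(y)`, for a set variable `F` and a number variable `b`. -/
def isECTBound (F b : ℕ) : Formula :=
  allN (imp (le (var (b + 1)) (var 0))
    (exN (and (lt (var 1) (var 0))
      (exN (and (mem (pair (var 2) (var 0)) F) (mem (pair (var 1) (var 0)) F))))))

/-- The sentence ECT: `∀ k ∀ F (F : ℕ → k implies ∃ b (b is a bound for F))`. -/
def ECTSentence : Formula :=
  allN (allS (imp (isFunction 0 0) (exN (isECTBound 0 0))))

/-- The sentence minECT:
`∀ k ∀ F (F : ℕ → k implies ∃ b (b is a bound for F and no b' < b is a bound for F))`. -/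
def minECTSentence : Formula :=
  allN (allS (imp (isFunction 0 0)
    (exN (and (isECTBound 0 0)
      (allN (imp (lt (var 0) (var 1)) (neg (isECTBound 0 0))))))))

end SOA

/-! Reduction: a least bound is in particular a bound, and least bounds exist classically, so the
identity reduces ECT to minECT.

No converse reduction: computable functionals are continuous
(`ComputableFunctional.eventually_mem`), and this contradicts the Baire category theorem on Cantor
space. Suppose `Φ`, `Ψ` reduce minECT to ECT, and write `J p` for the image under `Φ` of a
two-colouring `p`. Among the nonempty open `V` (on which `J p` has a fixed number of colours) and
thresholds `M`, choose a pair with the fewest colours appearing in `J p` at positions `≥ M` for `p ∈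
V`. By minimality no such colour can be lost on a smaller open set or beyond a larger threshold, so
for generic `q ∈ V` each of them occurs infinitely often in `J q`, and every `b ≥ M` is a bound for
`J q`. Some `p ∈ V` has nonzero least bound, which `Ψ` computes from a bound `b ≥ M` of `J p`. By
continuity `Ψ` gives the same answer for a generic `q` near `p`, where `b` is again a bound. But a
generic `q` uses both of its colours infinitely often, so its least bound is `0`.

Provable equivalence: by completeness (`SOA.proves_of_models`) one may argue inside an arbitrary
model. Only the step from ECT to minECT needs work (`exists_least_bound`), and it applies ECT twice.
Let `b` be a bound for `F`, and let `G(s)` be the least `u` such that every `x ∈ [u, b)` repeats its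
colour by stage `s`. `G` is definable with bounded quantifiers, takes values `≤ b` and is
nonincreasing. A bound for `G` is a point from which `G` is constant, and the limit value is the
least bound for `F`. The leastness principle is used only for bounded formulas. -/

/-! ### Continuity of computable functionals. -/

open Topology in
theorem ComputableFunctional.eventually_mem {F : (ℕ → ℕ) → ℕ →. ℕ} (hF : ComputableFunctional F)
    {g : ℕ → ℕ} {n y : ℕ} (h : y ∈ F g n) : ∀ᶠ g' in 𝓝 g, y ∈ F g' n := by
  induction hF generalizing n y with
  | zero | succ | left | right => exact .of_forall fun _ => h
  | oracle =>
    have : IsOpen ((fun g' : ℕ → ℕ => g' n) ⁻¹' {g n}) :=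
      (isOpen_discrete _).preimage (continuous_apply n)
    filter_upwards [this.mem_nhds rfl] with g' (hg' : g' n = g n)
    rwa [hg']
  | pair _ _ ihF ihH =>
    simp only [Seq.seq, Part.map_eq_map, Part.mem_bind_iff, Part.mem_map_iff] at h ⊢
    obtain ⟨_, ⟨a, ha, rfl⟩, b, hb, rfl⟩ := h
    filter_upwards [ihF ha, ihH hb] with g' h₁ h₂
    exact ⟨_, ⟨a, h₁, rfl⟩, b, h₂, rfl⟩
  | comp _ _ ihF ihH =>
    obtain ⟨a, ha, hy⟩ := Part.mem_bind_iff.1 h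
    filter_upwards [ihH ha, ihF hy] with g' h₁ h₂
    exact Part.mem_bind_iff.2 ⟨a, h₁, h₂⟩
  | prec _ _ ihF ihH =>
    dsimp only at h ⊢
    generalize n.unpair.2 = m at h ⊢
    induction m generalizing y with
    | zero => exact ihF h
    | succ m ih =>
      simp only [Part.bind_eq_bind, Part.mem_bind_iff] at h ⊢
      obtain ⟨a, ha, hy⟩ := h
      filter_upwards [ih ha, ihH hy] with g' h₁ h₂
      exact ⟨a, h₁, h₂⟩
  | @rfind F _ ih =>
    obtain ⟨hy, hlt⟩ := Nat.mem_rfind.1 h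
    obtain ⟨a, ha, ha'⟩ := (Part.mem_map_iff _).1 hy
    -- The search that stops at `y` made only finitely many tests, so the neighbourhoods for their
    -- results `c m` can be intersected.
    choose! c hc hc' using fun m (hm : m < y) => (Part.mem_map_iff _).1 (hlt hm)
    have : ∀ᶠ g' in 𝓝 g, ∀ m ∈ Set.Iio y, c m ∈ F g' (Nat.pair n m) :=
      (Filter.eventually_all_finite (Set.finite_Iio y)).2 fun m hm => ih (hc m hm)
    filter_upwards [ih ha, this] with g' h₁ h₂
    exact Nat.mem_rfind.2 ⟨(Part.mem_map_iff _).2 ⟨a, h₁, ha'⟩,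
      fun {m} hm => (Part.mem_map_iff _).2 ⟨c m, h₂ m hm, hc' m hm⟩⟩

theorem ComputableFunctional.isOpen_mem {F : (ℕ → ℕ) → ℕ →. ℕ} (hF : ComputableFunctional F)
    (n y : ℕ) : IsOpen {g | y ∈ F g n} :=
  isOpen_iff_mem_nhds.2 fun _ h => hF.eventually_mem h

theorem ComputableFunctional.id : ComputableFunctional fun _ n => Part.some n := by
  have := ComputableFunctional.pair .left .right
  convert this using 3 with g n
  simp [Seq.seq]

/-! ### The Weihrauch comparison of ECT and minECT. -/

theorem weihrauchLE_ECT_minECT : WeihrauchLE ECT minECT := by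
  refine ⟨_, _, .oracle, .id, ?_⟩
  rintro I ⟨b, hI, hb⟩
  classical
  refine ⟨I, ⟨Nat.find ⟨b, hb⟩, hI, Nat.find_spec ⟨b, hb⟩, fun c hc => Nat.find_min' _ hc⟩,
    fun n => Part.mem_some _, ?_⟩
  rintro S ⟨_, hS⟩
  exact ⟨S, Part.mem_some _, hI, hS.1⟩

/-- The code of a colouring with two colours. -/
def boolColoring (p : ℕ → Bool) : ℕ → ℕ
  | 0 => 2
  | n + 1 => (p n).toNat

theorem continuous_boolColoring : Continuous boolColoring := by
  refine continuous_pi fun n => ?_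
  cases n with
  | zero => exact continuous_const
  | succ n => exact (continuous_of_discreteTopology (f := Bool.toNat)).comp (continuous_apply n)

theorem boolColoring_mem_minECT_domain (p : ℕ → Bool) : boolColoring p ∈ minECT.domain := by
  have hc : CodesColoring (boolColoring p) := fun n => Bool.toNat_lt (p n)
  have hb : ∃ b, IsECTBound (fun n => boolColoring p (n + 1)) b := by
    -- If both colours recur forever, `0` is a bound. Otherwise one colour stops after some `m`, and
    -- from `m + 1` on the colouring is constant.
    by_cases h : ∀ c : Bool, ∀ m, ∃ n, m < n ∧ p n = c
    · refine ⟨0, fun x _ => ?_⟩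
      obtain ⟨y, hy, hpy⟩ := h (p x) x
      exact ⟨y, hy, by simp [boolColoring, hpy]⟩
    · push Not at h
      obtain ⟨c, m, h⟩ := h
      refine ⟨m + 1, fun x hx => ⟨x + 1, by omega, ?_⟩⟩
      have h₁ := h x (by omega)
      have h₂ := h (x + 1) (by omega)
      have : p x = p (x + 1) := by
        revert h₁ h₂
        cases p x <;> cases p (x + 1) <;> cases c <;> simp
      simp [boolColoring, this]
  classical
  exact ⟨Nat.find hb, hc, Nat.find_spec hb, fun c hc => Nat.find_min' _ hc⟩

theorem exists_nonzero_bound {V : Set (ℕ → Bool)} (hV : IsOpen V) (hne : V.Nonempty) :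
    ∃ p ∈ V, ¬ IsECTBound (fun n => boolColoring p (n + 1)) 0 := by
  obtain ⟨q, hq⟩ := hne
  obtain ⟨_, ⟨⟨r, n, rfl⟩, hqr, hsub⟩⟩ :=
    (PiNat.isTopologicalBasis_cylinders (fun _ : ℕ => Bool)).mem_nhds_iff.1 (hV.mem_nhds hq)
  -- Beyond the prefix that fixes the cylinder, colour `n` with `true` and everything later with
  -- `false`; the colour of `n` never returns.
  refine ⟨fun i => if i < n then r i else decide (i = n), hsub fun i hi => by simp [hi], fun h => ?_⟩
  obtain ⟨y, hy, he⟩ := h n (Nat.zero_le n)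
  simp [boolColoring, hy.not_gt, hy.ne'] at he

theorem dense_exists_ge_eq (c : Bool) (m : ℕ) : Dense {p : ℕ → Bool | ∃ n, m < n ∧ p n = c} := by
  rw [(PiNat.isTopologicalBasis_cylinders (fun _ : ℕ => Bool)).dense_iff]
  rintro _ ⟨r, n, rfl⟩ _
  refine ⟨fun i => if i < n then r i else c, fun i hi => by simp [hi], max n (m + 1), by omega, ?_⟩
  simp

theorem isOpen_exists_ge_eq (c : Bool) (m : ℕ) : IsOpen {p : ℕ → Bool | ∃ n, m < n ∧ p n = c} := by
  have : {p : ℕ → Bool | ∃ n, m < n ∧ p n = c} =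
      ⋃ n, ⋃ _ : m < n, (fun p : ℕ → Bool => p n) ⁻¹' {c} := by
    ext p
    simp
  rw [this]
  exact isOpen_iUnion fun n => isOpen_iUnion fun _ =>
    (isOpen_discrete _).preimage (continuous_apply n)

theorem not_weihrauchLE_minECT_ECT : ¬ WeihrauchLE minECT ECT := by
  rintro ⟨Φ, Ψ, hΦ, hΨ, h⟩
  choose J hJ hJΦ hR using fun p => h _ (boolColoring_mem_minECT_domain p)
  have hcol : ∀ p n, J p (n + 1) < J p 0 := fun p => by
    obtain ⟨_, hc, _⟩ := hJ p
    exact hc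
  -- `J p n` is the unique value of `Φ`, so each coordinate of `J` is a continuous function of `p`.
  have hJopen : ∀ n c, IsOpen {p | J p n = c} := by
    intro n c
    convert (hΦ.isOpen_mem n c).preimage continuous_boolColoring using 1
    ext p
    exact ⟨fun hp => hp ▸ hJΦ p n, fun hp => Part.mem_unique (hJΦ p n) hp⟩
  have hUopen : ∀ c M, IsOpen {p | ∃ i, M ≤ i ∧ J p (i + 1) = c} := by
    intro c M
    have : {p | ∃ i, M ≤ i ∧ J p (i + 1) = c} = ⋃ i, ⋃ _ : M ≤ i, {p | J p (i + 1) = c} := by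
      ext p
      simp
    rw [this]
    exact isOpen_iUnion fun i => isOpen_iUnion fun _ => hJopen _ _
  -- `C (V, M)` is the set of colours that `J p`, with `p` ranging over `V`, can still show from
  -- position `M` on.
  let C : Set (ℕ → Bool) × ℕ → Set ℕ := fun x => {c | ∃ p ∈ x.1, ∃ i, x.2 ≤ i ∧ J p (i + 1) = c}
  let k := J (fun _ => false) 0
  let A : Set (Set (ℕ → Bool) × ℕ) := {x | IsOpen x.1 ∧ x.1.Nonempty ∧ ∀ p ∈ x.1, J p 0 = k}
  have hA : A.Nonempty := ⟨({p | J p 0 = k}, 0), hJopen _ _, ⟨_, rfl⟩, fun _ hp => hp⟩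
  have hfin : ∀ x ∈ A, (C x).Finite := by
    rintro x ⟨_, _, hx⟩
    refine (Set.finite_Iio k).subset ?_
    rintro _ ⟨p, hp, i, _, rfl⟩
    exact hx p hp ▸ hcol p i
  obtain ⟨⟨V, M⟩, hVA, hmin⟩ : ∃ x ∈ A, ∀ y ∈ A, (C x).ncard ≤ (C y).ncard := by
    obtain ⟨x, hx, hx'⟩ := (InvImage.wf (fun x => (C x).ncard) Nat.lt_wfRel.wf).has_min A hA
    exact ⟨x, hx, fun y hy => not_lt.1 (hx' y hy)⟩
  obtain ⟨hV, hVne, hVk⟩ := id hVA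
  -- Shrinking `V` or raising `M` can only remove colours, and minimality of the finite cardinality
  -- forbids removing any.
  have hC : ∀ W ⊆ V, IsOpen W → W.Nonempty → ∀ M', M ≤ M' → C (V, M) ⊆ C (W, M') := by
    intro W hW hWo hWne M' hM'
    have hsub : C (W, M') ⊆ C (V, M) := by
      rintro c ⟨p, hp, i, hi, he⟩
      exact ⟨p, hW hp, i, hM'.trans hi, he⟩
    rw [Set.eq_of_subset_of_ncard_le hsub
      (hmin (W, M') ⟨hWo, hWne, fun p hp => hVk p (hW hp)⟩) (hfin _ hVA)]
  obtain ⟨p, hpV, hp⟩ := exists_nonzero_bound hV hVne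
  -- Numbers above a bound are bounds. Taking `b ≥ M` puts all colours from `b` on, for every
  -- colouring in `V`, into `C (V, M)`.
  obtain ⟨b, hMb, hb⟩ : ∃ b, M ≤ b ∧ (J p, b) ∈ ECT := by
    obtain ⟨b, hc, hb⟩ := hJ p
    exact ⟨max M b, le_max_left _ _, hc, fun x hx => hb x ((le_max_right _ _).trans hx)⟩
  obtain ⟨R, hRΨ, -, hRleast⟩ := hR p b hb
  let W := V ∩ boolColoring ⁻¹' {g | R ∈ Ψ g b}
  have hW : IsOpen W := hV.inter ((hΨ.isOpen_mem b R).preimage continuous_boolColoring)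
  -- The condition is generic only inside `V`; adding the exterior of `V` makes it open and dense in
  -- the whole space, as Baire's theorem requires.
  let D : ℕ × ℕ → Set (ℕ → Bool) := fun x =>
    {p | x.1 ∈ C (V, M) → ∃ i, x.2 ≤ i ∧ J p (i + 1) = x.1} ∪ (closure V)ᶜ
  have hDo : ∀ x, IsOpen (D x) := by
    intro x
    refine IsOpen.union ?_ isClosed_closure.isOpen_compl
    by_cases hx : x.1 ∈ C (V, M)
    · simpa [hx] using hUopen x.1 x.2
    · simp [hx]
  have hDd : ∀ x, Dense (D x) := by
    intro x
    rw [dense_iff_inter_open]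
    intro O hO hOne
    by_cases hOV : (O ∩ V).Nonempty
    · by_cases hx : x.1 ∈ C (V, M)
      · obtain ⟨q, hq, i, hi, he⟩ := hC (O ∩ V) Set.inter_subset_right (hO.inter hV) hOV
          (max M x.2) (le_max_left _ _) hx
        exact ⟨q, hq.1, .inl fun _ => ⟨i, (le_max_right _ _).trans hi, he⟩⟩
      · obtain ⟨q, hq⟩ := hOne
        exact ⟨q, hq, .inl fun hx' => (hx hx').elim⟩
    · obtain ⟨q, hq⟩ := hOne
      refine ⟨q, hq, .inr fun hqV => hOV ?_⟩
      exact mem_closure_iff.1 hqV O hO hq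
  let E : (ℕ × ℕ) ⊕ (Bool × ℕ) → Set (ℕ → Bool) :=
    Sum.elim D fun x => {p | ∃ n, x.2 < n ∧ p n = x.1}
  have hE : Dense (⋂ x, E x) := by
    refine dense_iInter_of_isOpen ?_ ?_
    · rintro (x | x)
      exacts [hDo x, isOpen_exists_ge_eq x.1 x.2]
    · rintro (x | x)
      exacts [hDd x, dense_exists_ge_eq x.1 x.2]
  -- `q` is generic, and close enough to `p` that `Ψ` still answers `R` on input `b`.
  obtain ⟨q, ⟨hqV, hqΨ⟩, hqE⟩ := hE.inter_open_nonempty W hW ⟨p, hpV, hRΨ⟩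
  rw [Set.mem_iInter] at hqE
  have hbq : (J q, b) ∈ ECT := by
    refine ⟨hcol q, fun x hx => ?_⟩
    have hx' : J q (x + 1) ∈ C (V, M) := ⟨q, hqV, x, hMb.trans hx, rfl⟩
    obtain ⟨i, hi, he⟩ := (hqE (.inl (J q (x + 1), x + 1))).resolve_right
      (fun hn => hn (subset_closure hqV)) hx'
    exact ⟨i, hi, he.symm⟩
  obtain ⟨R', hR'Ψ, -, hR'⟩ := hR q b hbq
  obtain rfl : R' = R := Part.mem_unique hR'Ψ hqΨ
  have h0 : R' ≤ 0 := hR'.2 fun x _ => by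
    obtain ⟨y, hy, hpy⟩ := hqE (.inr (q x, x))
    exact ⟨y, hy, by simp [boolColoring, hpy]⟩
  obtain rfl : R' = 0 := Nat.le_zero.1 h0
  exact hp hRleast.1

namespace SOA

/-! ### Substitution -/

theorem Term.subst_subst (σ τ : ℕ → Term) (t : Term) :
    (t.subst σ).subst τ = t.subst fun n => (σ n).subst τ := by
  induction t <;> simp_all [Term.subst]

theorem Term.subst_var (t : Term) : t.subst .var = t := by
  induction t <;> simp_all [Term.subst]

theorem liftN_comp (σ τ : ℕ → Term) :
    (fun n => (liftN σ n).subst (liftN τ)) = liftN fun n => (σ n).subst τ := by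
  funext n
  cases n with
  | zero => rfl
  | succ n => simp [liftN, Term.shift, Term.subst_subst, Term.subst]

theorem liftN_var : liftN .var = .var := by
  funext n
  cases n <;> rfl

theorem liftS_comp (ρ ρ' : ℕ → ℕ) : (liftS ρ' ∘ liftS ρ) = liftS (ρ' ∘ ρ) := by
  funext n
  cases n <;> rfl

theorem liftS_id : liftS id = id := by
  funext n
  cases n <;> rfl

namespace Formula

theorem subst_subst (φ : Formula) (σ τ : ℕ → Term) (ρ ρ' : ℕ → ℕ) :
    (φ.subst σ ρ).subst τ ρ' = φ.subst (fun n => (σ n).subst τ) (ρ' ∘ ρ) := by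
  induction φ generalizing σ τ ρ ρ' with
  | eq s t => simp [subst, Term.subst_subst]
  | lt s t => simp [subst, Term.subst_subst]
  | mem t X => simp [subst, Term.subst_subst]
  | fal => rfl
  | imp φ ψ hφ hψ => simp [subst, hφ, hψ]
  | allN φ h => simp only [subst, h, liftN_comp]
  | allS φ h => simp only [subst, h, liftS_comp]

theorem subst_var_id (φ : Formula) : φ.subst .var id = φ := by
  induction φ with
  | eq s t => simp [subst, Term.subst_var]
  | lt s t => simp [subst, Term.subst_var]
  | mem t X => simp [subst, Term.subst_var]
  | fal => rfl
  | imp φ ψ hφ hψ => simp [subst, hφ, hψ]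
  | allN φ h => simp [subst, liftN_var, h]
  | allS φ h => simp [subst, liftS_id, h]

end Formula

/-- All number variables of the term are below `k`. -/
def Term.Below (k : ℕ) : Term → Prop
  | .var n => n < k
  | .zero => True
  | .one => True
  | .add s t => s.Below k ∧ t.Below k
  | .mul s t => s.Below k ∧ t.Below k
  | .exp s t => s.Below k ∧ t.Below k

theorem Term.Below.mono {k k' : ℕ} (h : k ≤ k') {t : Term} (ht : t.Below k) : t.Below k' := by
  induction t with
  | var n => exact lt_of_lt_of_le ht h
  | zero => trivial
  | one => trivial
  | add s t hs ht' => exact ⟨hs ht.1, ht' ht.2⟩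
  | mul s t hs ht' => exact ⟨hs ht.1, ht' ht.2⟩
  | exp s t hs ht' => exact ⟨hs ht.1, ht' ht.2⟩

theorem Term.exists_below (t : Term) : ∃ k, t.Below k := by
  induction t with
  | var n => exact ⟨n + 1, Nat.lt_succ_self n⟩
  | zero => exact ⟨0, trivial⟩
  | one => exact ⟨0, trivial⟩
  | add s t hs ht | mul s t hs ht | exp s t hs ht =>
    obtain ⟨a, ha⟩ := hs
    obtain ⟨b, hb⟩ := ht
    exact ⟨max a b, ha.mono (le_max_left a b), hb.mono (le_max_right a b)⟩

theorem Term.subst_congr {k : ℕ} {t : Term} (ht : t.Below k) {σ τ : ℕ → Term}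
    (h : ∀ n < k, σ n = τ n) : t.subst σ = t.subst τ := by
  induction t with
  | var n => exact h n ht
  | zero => rfl
  | one => rfl
  | add s t hs ht' => simp [Term.subst, hs ht.1, ht' ht.2]
  | mul s t hs ht' => simp [Term.subst, hs ht.1, ht' ht.2]
  | exp s t hs ht' => simp [Term.subst, hs ht.1, ht' ht.2]

/-- Add a value in front of a sequence. -/
def scons {α : Type} (a : α) (v : ℕ → α) : ℕ → α
  | 0 => a
  | n + 1 => v n

namespace Formula

/-- All free number variables are below `k` and all free set variables are below `l`. -/
def Below : ℕ → ℕ → Formula → Prop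
  | k, _, eq s t => s.Below k ∧ t.Below k
  | k, _, lt s t => s.Below k ∧ t.Below k
  | k, l, mem t X => t.Below k ∧ X < l
  | _, _, fal => True
  | k, l, imp φ ψ => φ.Below k l ∧ ψ.Below k l
  | k, l, allN φ => φ.Below (k + 1) l
  | k, l, allS φ => φ.Below k (l + 1)

theorem Below.mono {k k' l l' : ℕ} (hk : k ≤ k') (hl : l ≤ l') {φ : Formula}
    (hφ : φ.Below k l) : φ.Below k' l' := by
  induction φ generalizing k k' l l' with
  | eq s t => exact ⟨hφ.1.mono hk, hφ.2.mono hk⟩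
  | lt s t => exact ⟨hφ.1.mono hk, hφ.2.mono hk⟩
  | mem t X => exact ⟨hφ.1.mono hk, hφ.2.trans_le hl⟩
  | fal => trivial
  | imp φ ψ h₁ h₂ => exact ⟨h₁ hk hl hφ.1, h₂ hk hl hφ.2⟩
  | allN φ h => exact h (Nat.succ_le_succ hk) hl hφ
  | allS φ h => exact h hk (Nat.succ_le_succ hl) hφ

theorem exists_below (φ : Formula) : ∃ k, φ.Below k k := by
  induction φ with
  | eq s t | lt s t =>
    obtain ⟨a, ha⟩ := s.exists_below
    obtain ⟨b, hb⟩ := t.exists_below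
    exact ⟨max a b, ha.mono (le_max_left a b), hb.mono (le_max_right a b)⟩
  | mem t X =>
    obtain ⟨a, ha⟩ := t.exists_below
    exact ⟨max a (X + 1), ha.mono (le_max_left _ _), lt_of_lt_of_le X.lt_succ_self (le_max_right _ _)⟩
  | fal => exact ⟨0, trivial⟩
  | imp φ ψ h₁ h₂ =>
    obtain ⟨a, ha⟩ := h₁
    obtain ⟨b, hb⟩ := h₂
    exact ⟨max a b, ha.mono (le_max_left a b) (le_max_left a b),
      hb.mono (le_max_right a b) (le_max_right a b)⟩
  | allN φ h =>
    obtain ⟨a, ha⟩ := h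
    exact ⟨a, ha.mono (Nat.le_succ a) le_rfl⟩
  | allS φ h =>
    obtain ⟨a, ha⟩ := h
    exact ⟨a, ha.mono le_rfl (Nat.le_succ a)⟩

theorem exists_below_list (Γ : List Formula) : ∃ k, ∀ φ ∈ Γ, φ.Below k k := by
  induction Γ with
  | nil => exact ⟨0, by simp⟩
  | cons φ Γ h =>
    obtain ⟨a, ha⟩ := φ.exists_below
    obtain ⟨b, hb⟩ := h
    refine ⟨max a b, ?_⟩
    rintro ψ (_ | ⟨_, hψ⟩)
    · exact ha.mono (le_max_left a b) (le_max_left a b)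
    · exact (hb _ hψ).mono (le_max_right a b) (le_max_right a b)

theorem subst_congr {k l : ℕ} {φ : Formula} (hφ : φ.Below k l) {σ τ : ℕ → Term} {ρ ρ' : ℕ → ℕ}
    (h : ∀ n < k, σ n = τ n) (h' : ∀ n < l, ρ n = ρ' n) : φ.subst σ ρ = φ.subst τ ρ' := by
  induction φ generalizing k l σ τ ρ ρ' with
  | eq s t => simp [subst, Term.subst_congr hφ.1 h, Term.subst_congr hφ.2 h]
  | lt s t => simp [subst, Term.subst_congr hφ.1 h, Term.subst_congr hφ.2 h]
  | mem t X => simp [subst, Term.subst_congr hφ.1 h, h' X hφ.2]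
  | fal => rfl
  | imp φ ψ h₁ h₂ => simp [subst, h₁ hφ.1 h h', h₂ hφ.2 h h']
  | allN φ ih =>
    simp only [subst, allN.injEq]
    refine ih hφ (fun n hn => ?_) h'
    cases n with
    | zero => rfl
    | succ n => simp [liftN, h n (by omega)]
  | allS φ ih =>
    simp only [subst, allS.injEq]
    refine ih hφ h (fun n hn => ?_)
    cases n with
    | zero => rfl
    | succ n => simp [liftS, h' n (by omega)]

theorem subst_liftN_instN (φ : Formula) (σ : ℕ → Term) (ρ : ℕ → ℕ) (t : Term) :
    (φ.subst (liftN σ) ρ).instN t = φ.subst (scons t σ) ρ := by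
  unfold instN
  rw [subst_subst]
  congr 1
  funext n
  cases n with
  | zero => rfl
  | succ n => simp [liftN, Term.shift, Term.subst_subst, Term.subst, Term.subst_var, scons]

theorem subst_liftS_instS (φ : Formula) (σ : ℕ → Term) (ρ : ℕ → ℕ) (Y : ℕ) :
    (φ.subst σ (liftS ρ)).instS Y = φ.subst σ (scons Y ρ) := by
  unfold instS
  rw [subst_subst]
  congr 1
  · simp [Term.subst_var]
  · funext n
    cases n <;> rfl

theorem instN_subst (φ : Formula) (σ : ℕ → Term) (ρ : ℕ → ℕ) (t : Term) :
    (φ.instN t).subst σ ρ = (φ.subst (liftN σ) ρ).instN (t.subst σ) := by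
  rw [subst_liftN_instN]
  unfold instN
  rw [subst_subst]
  congr 1
  funext n
  cases n <;> rfl

theorem instS_subst (φ : Formula) (σ : ℕ → Term) (ρ : ℕ → ℕ) (Y : ℕ) :
    (φ.instS Y).subst σ ρ = (φ.subst σ (liftS ρ)).instS (ρ Y) := by
  rw [subst_liftS_instS]
  unfold instS
  rw [subst_subst]
  congr 1
  funext n
  cases n <;> rfl

theorem shiftN_subst (φ : Formula) (σ : ℕ → Term) (ρ : ℕ → ℕ) :
    φ.shiftN.subst (liftN σ) ρ = (φ.subst σ ρ).shiftN := by
  unfold shiftN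
  rw [subst_subst, subst_subst]
  rfl

theorem shiftS_subst (φ : Formula) (σ : ℕ → Term) (ρ : ℕ → ℕ) :
    φ.shiftS.subst σ (liftS ρ) = (φ.subst σ ρ).shiftS := by
  unfold shiftS
  rw [subst_subst, subst_subst]
  congr 1
  simp [Term.subst_var, Term.subst]

end Formula

/-! ### Derivations -/

namespace Derives

open Formula

variable {T : Set Formula}

theorem weaken {Γ Δ : List Formula} {φ : Formula} (h : Derives T Γ φ) (hΓ : Γ ⊆ Δ) :
    Derives T Δ φ := by
  induction h generalizing Δ with
  | ax h => exact .ax h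
  | hyp h => exact .hyp (hΓ h)
  | impI _ ih => exact .impI (ih (List.cons_subset_cons _ hΓ))
  | impE _ _ ih₁ ih₂ => exact .impE (ih₁ hΓ) (ih₂ hΓ)
  | raa _ ih => exact .raa (ih (List.cons_subset_cons _ hΓ))
  | allNI _ ih => exact .allNI (ih (List.map_subset _ hΓ))
  | allNE t _ ih => exact .allNE t (ih hΓ)
  | allSI _ ih => exact .allSI (ih (List.map_subset _ hΓ))
  | allSE Y _ ih => exact .allSE Y (ih hΓ)
  | eqRefl t => exact .eqRefl t
  | eqSubst s t _ _ ih₁ ih₂ => exact .eqSubst s t (ih₁ hΓ) (ih₂ hΓ)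

/-- The variables are generalized and instantiated one at a time. Derivability is assumed in every
context because generalization shifts the context. -/
theorem substN_of_below {k l : ℕ} {φ : Formula} (hφ : φ.Below k l)
    (h : ∀ Γ, Derives T Γ φ) (σ : ℕ → Term) (Γ : List Formula) :
    Derives T Γ (φ.subst σ id) := by
  induction k generalizing φ σ Γ with
  | zero =>
    rw [subst_congr (τ := .var) (ρ' := id) hφ (by simp) (by simp), subst_var_id]
    exact h Γ
  | succ k ih =>
    have := (ih (φ := allN φ) hφ (fun Γ => .allNI (h _)) (fun n => σ (n + 1)) Γ).allNE (σ 0)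
    rw [subst_liftN_instN] at this
    convert this using 2
    funext n
    cases n <;> rfl

theorem substS_of_below {k l : ℕ} {φ : Formula} (hφ : φ.Below k l)
    (h : ∀ Γ, Derives T Γ φ) (ρ : ℕ → ℕ) (Γ : List Formula) :
    Derives T Γ (φ.subst .var ρ) := by
  induction l generalizing φ ρ Γ with
  | zero =>
    rw [subst_congr (τ := .var) (ρ' := id) hφ (by simp) (by simp), subst_var_id]
    exact h Γ
  | succ l ih =>
    have := (ih (φ := allS φ) hφ (fun Γ => .allSI (h _)) (fun n => ρ (n + 1)) Γ).allSE (ρ 0)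
    rw [subst_liftS_instS] at this
    convert this using 2
    funext n
    cases n <;> rfl

/-- Justifies reading open axioms as their universal closures; it is also the axiom case of
`Derives.subst`. -/
theorem ax_subst {φ : Formula} (h : φ ∈ T) (σ : ℕ → Term) (ρ : ℕ → ℕ) (Γ : List Formula) :
    Derives T Γ (φ.subst σ ρ) := by
  obtain ⟨k, hk⟩ := φ.exists_below
  have h₁ := fun Γ => substS_of_below hk (fun _ => .ax h) ρ Γ
  obtain ⟨l, hl⟩ := (φ.subst .var ρ).exists_below
  have h₂ := substN_of_below hl h₁ σ Γ
  rw [subst_subst] at h₂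
  exact h₂

theorem subst {Γ : List Formula} {φ : Formula} (h : Derives T Γ φ) (σ : ℕ → Term) (ρ : ℕ → ℕ) :
    Derives T (Γ.map (Formula.subst σ ρ)) (φ.subst σ ρ) := by
  induction h generalizing σ ρ with
  | ax h => exact ax_subst h σ ρ _
  | hyp h => exact .hyp (List.mem_map_of_mem h)
  | impI _ ih => exact .impI (ih σ ρ)
  | impE _ _ ih₁ ih₂ => exact .impE (ih₁ σ ρ) (ih₂ σ ρ)
  | raa _ ih => exact .raa (ih σ ρ)
  | allNI _ ih =>
    refine .allNI ?_
    have := ih (liftN σ) ρ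
    simpa only [List.map_map, Function.comp_def, shiftN_subst] using this
  | allNE t _ ih => rw [instN_subst]; exact .allNE _ (ih σ ρ)
  | allSI _ ih =>
    refine .allSI ?_
    have := ih σ (liftS ρ)
    simpa only [List.map_map, Function.comp_def, shiftS_subst] using this
  | allSE Y _ ih => rw [instS_subst]; exact .allSE _ (ih σ ρ)
  | eqRefl t => exact .eqRefl _
  | eqSubst s t _ _ ih₁ ih₂ =>
    rw [instN_subst]
    refine .eqSubst (s.subst σ) _ (ih₁ σ ρ) ?_
    rw [← instN_subst]
    exact ih₂ σ ρ

/-- Named-variable form of generalization: rename the fresh variable `k` to `0` and shift the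
others, which turns the context into its shift. -/
theorem allN_of_fresh {Γ : List Formula} {φ : Formula} {k l : ℕ} (hΓ : ∀ ψ ∈ Γ, ψ.Below k l)
    (hφ : (allN φ).Below k l) (h : Derives T Γ (φ.instN (.var k))) : Derives T Γ (allN φ) := by
  have h' := h.subst (fun n => if n = k then .var 0 else .var (n + 1)) id
  refine .allNI ?_
  convert h' using 1
  · refine List.map_congr_left fun ψ hψ => subst_congr (hΓ ψ hψ) (fun n hn => ?_) (by simp)
    simp [hn.ne]
  · rw [instN, subst_subst]
    conv_lhs => rw [← subst_var_id φ]
    refine subst_congr (k := k + 1) (l := l) hφ (fun n hn => ?_) (by simp)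
    cases n with
    | zero => simp [Term.subst]
    | succ n => simp [Term.subst, (show n ≠ k by omega)]

theorem allS_of_fresh {Γ : List Formula} {φ : Formula} {k l : ℕ} (hΓ : ∀ ψ ∈ Γ, ψ.Below k l)
    (hφ : (allS φ).Below k l) (h : Derives T Γ (φ.instS l)) : Derives T Γ (allS φ) := by
  have h' := h.subst .var (fun n => if n = l then 0 else n + 1)
  refine .allSI ?_
  convert h' using 1
  · refine List.map_congr_left fun ψ hψ => subst_congr (hΓ ψ hψ) (by simp) (fun n hn => ?_)
    simp [hn.ne]
  · rw [instS, subst_subst]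
    conv_lhs => rw [← subst_var_id φ]
    refine subst_congr (k := k) (l := l + 1) hφ (by simp [Term.subst]) (fun n hn => ?_)
    cases n with
    | zero => simp
    | succ n => simp [(show n ≠ l by omega)]

theorem exfalso {Γ : List Formula} {φ : Formula} (h : Derives T Γ fal) : Derives T Γ φ :=
  .raa (h.weaken (List.subset_cons_self _ _))

theorem negE {Γ : List Formula} {φ : Formula} (h : Derives T Γ (neg φ)) (h' : Derives T Γ φ) :
    Derives T Γ fal := .impE h h'

end Derives

/-! ### Henkin sets -/

open Formula

theorem countable_term : Countable Term := by
  let e : Term → ℕ := fun t => Term.rec (fun n => 6 * n) 1 2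
    (fun _ _ a b => 6 * Nat.pair a b + 3) (fun _ _ a b => 6 * Nat.pair a b + 4)
    (fun _ _ a b => 6 * Nat.pair a b + 5) t
  refine Function.Injective.countable (f := e) ?_
  intro s
  induction s <;> intro t h <;> cases t <;> simp only [e] at h <;> grind [Nat.pair_eq_pair]

theorem countable_formula : Countable Formula := by
  obtain ⟨c, hc⟩ := (countable_iff_exists_injective Term).1 countable_term
  let e : Formula → ℕ := fun t => Formula.rec (fun s t => 7 * Nat.pair (c s) (c t))
    (fun s t => 7 * Nat.pair (c s) (c t) + 1) (fun t X => 7 * Nat.pair (c t) X + 2) 3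
    (fun _ _ a b => 7 * Nat.pair a b + 4) (fun _ a => 7 * a + 5) (fun _ a => 7 * a + 6) t
  refine Function.Injective.countable (f := e) ?_
  intro s
  have hc' := fun a b => hc.eq_iff (a := a) (b := b)
  induction s <;> intro t h <;> cases t <;> simp only [e] at h <;> grind [Nat.pair_eq_pair]

/-- Each stage is a finite list, so some variable is always fresh and can witness a refuted
universal formula. No new constants are needed. -/
theorem exists_henkin_step {T : Set Formula} {Γ : List Formula} (hΓ : ¬ Derives T Γ fal)
    (ψ : Formula) : ∃ Γ', Γ ⊆ Γ' ∧ ¬ Derives T Γ' fal ∧ (ψ ∈ Γ' ∨ neg ψ ∈ Γ') ∧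
      (∀ χ, ψ = allN χ → neg ψ ∈ Γ' → ∃ t, neg (χ.instN t) ∈ Γ') ∧
      (∀ χ, ψ = allS χ → neg ψ ∈ Γ' → ∃ Y, neg (χ.instS Y) ∈ Γ') := by
  by_cases h : Derives T (ψ :: Γ) fal
  · have hn : ¬ Derives T (neg ψ :: Γ) fal := fun h' => hΓ (.impE (.impI h) (.raa h'))
    obtain ⟨k, hk⟩ := exists_below_list (neg ψ :: Γ)
    have hψ : ψ.Below k k := (hk (neg ψ) (by simp)).1
    by_cases hN : ∃ χ, ψ = allN χ
    · obtain ⟨χ, rfl⟩ := hN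
      refine ⟨neg (χ.instN (.var k)) :: neg (allN χ) :: Γ, ?_, ?_, by simp, ?_, by simp⟩
      · exact fun x hx => by simp [hx]
      · exact fun h' => hn (.negE (.hyp (by simp)) (.allN_of_fresh hk hψ (.raa h')))
      · intro χ' hχ _
        cases hχ
        exact ⟨_, List.mem_cons_self⟩
    by_cases hS : ∃ χ, ψ = allS χ
    · obtain ⟨χ, rfl⟩ := hS
      refine ⟨neg (χ.instS k) :: neg (allS χ) :: Γ, ?_, ?_, by simp, by simp, ?_⟩
      · exact fun x hx => by simp [hx]
      · exact fun h' => hn (.negE (.hyp (by simp)) (.allS_of_fresh hk hψ (.raa h')))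
      · intro χ' hχ _
        cases hχ
        exact ⟨_, List.mem_cons_self⟩
    exact ⟨neg ψ :: Γ, List.subset_cons_self _ _, hn, by simp,
      fun χ hχ => (hN ⟨χ, hχ⟩).elim, fun χ hχ => (hS ⟨χ, hχ⟩).elim⟩
  · have hne : neg ψ ∉ ψ :: Γ := fun hm => h (.negE (.hyp hm) (.hyp (by simp)))
    exact ⟨ψ :: Γ, List.subset_cons_self _ _, h, by simp,
      fun _ _ hm => (hne hm).elim, fun _ _ hm => (hne hm).elim⟩

/-- A deductively closed, complete, consistent set of formulas with number and set variables as
witnesses. -/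
structure IsHenkin (T : Set Formula) (Δ : Set Formula) : Prop where
  closed {Γ : List Formula} {φ : Formula} : (∀ ψ ∈ Γ, ψ ∈ Δ) → Derives T Γ φ → φ ∈ Δ
  fal_notMem : fal ∉ Δ
  mem_or (φ : Formula) : φ ∈ Δ ∨ neg φ ∈ Δ
  allN {φ : Formula} : (∀ t, φ.instN t ∈ Δ) → allN φ ∈ Δ
  allS {φ : Formula} : (∀ Y, φ.instS Y ∈ Δ) → allS φ ∈ Δ

theorem exists_isHenkin {T : Set Formula} {Γ₀ : List Formula} (h₀ : ¬ Derives T Γ₀ fal) :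
    ∃ Δ, IsHenkin T Δ ∧ ∀ φ ∈ Γ₀, φ ∈ Δ := by
  have := countable_formula
  have : Nonempty Formula := ⟨fal⟩
  obtain ⟨e, he⟩ := exists_surjective_nat Formula
  choose! step h₁ h₂ h₃ h₄ h₅ using fun Γ hΓ ψ => exists_henkin_step (T := T) (Γ := Γ) hΓ ψ
  let G : ℕ → List Formula := fun n => Nat.rec Γ₀ (fun n Γ => step Γ (e n)) n
  have hG : ∀ n, ¬ Derives T (G n) fal := by
    intro n
    induction n with
    | zero => exact h₀
    | succ n ih => exact h₂ _ ih _
  have hmono : ∀ m n, m ≤ n → G m ⊆ G n := by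
    intro m n hmn
    induction n, hmn using Nat.le_induction with
    | base => exact List.Subset.refl _
    | succ n _ ih => exact List.Subset.trans ih (h₁ _ (hG n) _)
  have hor : ∀ φ, (∃ n, φ ∈ G n) ∨ ∃ n, neg φ ∈ G n := by
    intro φ
    obtain ⟨n, rfl⟩ := he φ
    exact (h₃ _ (hG n) (e n)).imp (fun h => ⟨n + 1, h⟩) fun h => ⟨n + 1, h⟩
  have hcons : ∀ φ, (∃ n, φ ∈ G n) → ¬ ∃ n, neg φ ∈ G n := by
    rintro φ ⟨m, hm⟩ ⟨n, hn⟩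
    exact hG (max m n) (.negE (.hyp (hmono _ _ (le_max_right _ _) hn))
      (.hyp (hmono _ _ (le_max_left _ _) hm)))
  have hfin : ∀ Γ : List Formula, (∀ ψ ∈ Γ, ∃ n, ψ ∈ G n) → ∃ n, Γ ⊆ G n := by
    intro Γ
    induction Γ with
    | nil => exact fun _ => ⟨0, by simp⟩
    | cons ψ Γ ih =>
      intro h
      obtain ⟨m, hm⟩ := h ψ (by simp)
      obtain ⟨n, hn⟩ := ih fun χ hχ => h χ (by simp [hχ])
      exact ⟨max m n, List.cons_subset.2 ⟨hmono _ _ (le_max_left _ _) hm,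
        List.Subset.trans hn (hmono _ _ (le_max_right _ _))⟩⟩
  have hclosed : ∀ {Γ : List Formula} {φ : Formula}, (∀ ψ ∈ Γ, ∃ n, ψ ∈ G n) →
      Derives T Γ φ → ∃ n, φ ∈ G n := by
    -- Every formula gets decided, and deciding `φ` negatively would make some stage inconsistent.
    intro Γ φ hΓ hd
    refine (hor φ).resolve_right ?_
    rintro ⟨m, hm⟩
    obtain ⟨n, hn⟩ := hfin Γ hΓ
    exact hG (max m n) (.negE (.hyp (hmono _ _ (le_max_left _ _) hm))
      (hd.weaken (List.Subset.trans hn (hmono _ _ (le_max_right _ _)))))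
  refine ⟨{φ | ∃ n, φ ∈ G n}, ⟨hclosed, ?_, hor, ?_, ?_⟩, fun φ hφ => ⟨0, hφ⟩⟩
  · rintro ⟨n, hn⟩
    exact hG n (.hyp hn)
  · intro φ hφ
    refine Classical.byContradiction fun hall => ?_
    obtain ⟨n, hn⟩ := he (Formula.allN φ)
    have hm := (h₃ _ (hG n) (e n)).resolve_left fun h => hall ⟨n + 1, hn ▸ h⟩
    obtain ⟨t, ht⟩ := h₄ _ (hG n) (e n) φ hn hm
    exact hcons _ (hφ t) ⟨n + 1, ht⟩
  · intro φ hφ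
    refine Classical.byContradiction fun hall => ?_
    obtain ⟨n, hn⟩ := he (Formula.allS φ)
    have hm := (h₃ _ (hG n) (e n)).resolve_left fun h => hall ⟨n + 1, hn ▸ h⟩
    obtain ⟨t, ht⟩ := h₅ _ (hG n) (e n) φ hn hm
    exact hcons _ (hφ t) ⟨n + 1, ht⟩

/-! ### Structures and the completeness theorem -/

/-- Two-sorted structures for the language `L₂(exp)`. -/
structure Struc where
  N : Type
  S : Type
  zero : N
  one : N
  add : N → N → N
  mul : N → N → N
  exp : N → N → N
  lt : N → N → Prop
  mem : N → S → Prop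

/-- The value of a term. -/
def Term.eval (M : Struc) (v : ℕ → M.N) : Term → M.N
  | .var n => v n
  | .zero => M.zero
  | .one => M.one
  | .add s t => M.add (s.eval M v) (t.eval M v)
  | .mul s t => M.mul (s.eval M v) (t.eval M v)
  | .exp s t => M.exp (s.eval M v) (t.eval M v)

/-- Satisfaction of a formula under assignments to number and set variables. -/
def Formula.Sat (M : Struc) : (ℕ → M.N) → (ℕ → M.S) → Formula → Prop
  | v, _, .eq s t => s.eval M v = t.eval M v
  | v, _, .lt s t => M.lt (s.eval M v) (t.eval M v)
  | v, w, .mem t X => M.mem (t.eval M v) (w X)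
  | _, _, .fal => False
  | v, w, .imp φ ψ => φ.Sat M v w → ψ.Sat M v w
  | v, w, .allN φ => ∀ a, φ.Sat M (scons a v) w
  | v, w, .allS φ => ∀ A, φ.Sat M v (scons A w)

namespace IsHenkin

variable {T Δ : Set Formula} (hΔ : IsHenkin T Δ)
include hΔ

theorem imp_mem_iff {φ ψ : Formula} : imp φ ψ ∈ Δ ↔ (φ ∈ Δ → ψ ∈ Δ) := by
  constructor
  · intro h h'
    exact hΔ.closed (Γ := [imp φ ψ, φ]) (by simp [h, h']) (.impE (φ := φ) (.hyp (by simp)) (.hyp (by simp)))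
  · intro h
    rcases hΔ.mem_or φ with h' | h'
    · exact hΔ.closed (Γ := [ψ]) (by simp [h h']) (.impI (.hyp (by simp)))
    · exact hΔ.closed (Γ := [neg φ]) (by simp [h'])
        (.impI (.exfalso (.negE (φ := φ) (.hyp (by simp)) (.hyp (by simp)))))

theorem allN_mem_iff {φ : Formula} : Formula.allN φ ∈ Δ ↔ ∀ t, φ.instN t ∈ Δ :=
  ⟨fun h t => hΔ.closed (Γ := [Formula.allN φ]) (by simp [h]) (.allNE t (.hyp (by simp))), hΔ.allN⟩

theorem allS_mem_iff {φ : Formula} : Formula.allS φ ∈ Δ ↔ ∀ Y, φ.instS Y ∈ Δ :=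
  ⟨fun h t => hΔ.closed (Γ := [Formula.allS φ]) (by simp [h]) (.allSE t (.hyp (by simp))), hΔ.allS⟩

theorem instN_mem {φ : Formula} {s t : Term} (h : eq s t ∈ Δ) (h' : φ.instN s ∈ Δ) :
    φ.instN t ∈ Δ :=
  hΔ.closed (Γ := [eq s t, φ.instN s]) (by simp [h, h'])
    (.eqSubst s t (.hyp (by simp)) (.hyp (by simp)))

theorem eq_refl (t : Term) : eq t t ∈ Δ := hΔ.closed (Γ := []) (by simp) (.eqRefl t)

theorem eq_symm {s t : Term} (h : eq s t ∈ Δ) : eq t s ∈ Δ := by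
  have := hΔ.instN_mem (φ := eq (.var 0) s.shift) h
  simp only [instN, Formula.subst, Term.subst, Term.shift, Term.subst_subst, Term.subst_var] at this
  exact this (hΔ.eq_refl s)

theorem eq_trans {s t u : Term} (h : eq s t ∈ Δ) (h' : eq t u ∈ Δ) : eq s u ∈ Δ := by
  have := hΔ.instN_mem (φ := eq s.shift (.var 0)) h'
  simp only [instN, Formula.subst, Term.subst, Term.shift, Term.subst_subst, Term.subst_var] at this
  exact this h

theorem eq_subst (r : Term) {s t : Term} (h : eq s t ∈ Δ) (σ : ℕ → Term) :
    eq (r.subst (scons s σ)) (r.subst (scons t σ)) ∈ Δ := by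
  have := hΔ.instN_mem (φ := eq (r.subst (scons s σ)).shift (r.subst (liftN σ))) h
  have key : ∀ u, (fun n => (liftN σ n).subst fun n => Nat.casesOn n u Term.var) = scons u σ := by
    intro u
    funext n
    cases n with
    | zero => rfl
    | succ n => simp [liftN, Term.shift, Term.subst_subst, Term.subst, Term.subst_var, scons]
  simp only [instN, Formula.subst, Term.shift, Term.subst_subst, key] at this
  simp only [Term.subst, Term.subst_var] at this
  exact this (hΔ.eq_refl _)

/-- Equality of terms according to a Henkin set. -/
def setoid : Setoid Term where
  r s t := eq s t ∈ Δ
  iseqv := ⟨hΔ.eq_refl, hΔ.eq_symm, hΔ.eq_trans⟩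

theorem congr₂ (f : Term → Term → Term)
    (hf : ∀ s t σ, (f s t).subst σ = f (s.subst σ) (t.subst σ)) {s s' t t' : Term}
    (h : eq s s' ∈ Δ) (h' : eq t t' ∈ Δ) : eq (f s t) (f s' t') ∈ Δ := by
  have h₁ := hΔ.eq_subst (f (.var 0) (.var 1)) h fun _ => t
  have h₂ := hΔ.eq_subst (f (.var 1) (.var 0)) h' fun _ => s'
  simp only [hf, Term.subst, scons] at h₁ h₂
  exact hΔ.eq_trans h₁ h₂

/-- The term model of a Henkin set. -/
def model : Struc where
  N := Quotient hΔ.setoid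
  S := ℕ
  zero := Quotient.mk _ .zero
  one := Quotient.mk _ .one
  add := Quotient.map₂ .add fun _ _ h _ _ h' => hΔ.congr₂ .add (fun _ _ _ => rfl) h h'
  mul := Quotient.map₂ .mul fun _ _ h _ _ h' => hΔ.congr₂ .mul (fun _ _ _ => rfl) h h'
  exp := Quotient.map₂ .exp fun _ _ h _ _ h' => hΔ.congr₂ .exp (fun _ _ _ => rfl) h h'
  lt a b := ∃ s t, a = Quotient.mk _ s ∧ b = Quotient.mk _ t ∧ lt s t ∈ Δ
  mem a X := ∃ s, a = Quotient.mk _ s ∧ mem s X ∈ Δ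

theorem eval_model (σ : ℕ → Term) (t : Term) :
    t.eval hΔ.model (fun n => Quotient.mk hΔ.setoid (σ n)) =
      Quotient.mk hΔ.setoid (t.subst σ) := by
  induction t with
  | var n => rfl
  | zero => rfl
  | one => rfl
  | add s t hs ht | mul s t hs ht | exp s t hs ht => simp only [Term.eval, hs, ht]; rfl

theorem sat_model (φ : Formula) (σ : ℕ → Term) (ρ : ℕ → ℕ) :
    φ.Sat hΔ.model (fun n => Quotient.mk hΔ.setoid (σ n)) ρ ↔ φ.subst σ ρ ∈ Δ := by
  induction φ generalizing σ ρ with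
  | eq s t => simp only [Sat, eval_model, Formula.subst]; exact Quotient.eq (r := hΔ.setoid)
  | lt s t =>
    simp only [Sat, eval_model, Formula.subst]
    constructor
    · rintro ⟨s', t', hs, ht, h⟩
      replace hs := hΔ.eq_symm (Quotient.exact (s := hΔ.setoid) hs)
      replace ht := hΔ.eq_symm (Quotient.exact (s := hΔ.setoid) ht)
      have h₁ := hΔ.instN_mem (φ := lt (.var 0) t'.shift) hs
      have h₂ := hΔ.instN_mem (φ := lt (s.subst σ).shift (.var 0)) ht
      simp only [instN, Formula.subst, Term.subst, Term.shift, Term.subst_subst,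
        Term.subst_var] at h₁ h₂
      exact h₂ (h₁ h)
    · exact fun h => ⟨_, _, rfl, rfl, h⟩
  | mem t X =>
    simp only [Sat, eval_model, Formula.subst]
    constructor
    · rintro ⟨s', hs, h⟩
      replace hs := hΔ.eq_symm (Quotient.exact (s := hΔ.setoid) hs)
      exact hΔ.instN_mem (φ := mem (.var 0) (ρ X)) hs h
    · exact fun h => ⟨_, rfl, h⟩
  | fal => exact iff_of_false id hΔ.fal_notMem
  | imp φ ψ h₁ h₂ => simp only [Sat, h₁, h₂, Formula.subst, hΔ.imp_mem_iff]
  | allN φ ih =>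
    simp only [Sat, Formula.subst, hΔ.allN_mem_iff, subst_liftN_instN, ← ih]
    have key : ∀ t, (fun n => Quotient.mk hΔ.setoid (scons t σ n)) =
        scons (Quotient.mk hΔ.setoid t) fun n => Quotient.mk hΔ.setoid (σ n) := by
      intro t
      funext n
      cases n <;> rfl
    simp only [key]
    exact ⟨fun h t => h _, fun h a => Quotient.inductionOn a h⟩
  | allS φ ih =>
    simp only [Sat, Formula.subst, hΔ.allS_mem_iff, subst_liftS_instS, ← ih]
    exact Iff.rfl

end IsHenkin

/-- Completeness: what holds in all models of `T` is provable from `T`. -/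
theorem proves_of_models {T : Set Formula} {ψ : Formula}
    (h : ∀ M : Struc, (∀ φ ∈ T, ∀ v w, φ.Sat M v w) → ∀ v w, ψ.Sat M v w) : Proves T ψ := by
  by_contra hψ
  have h₀ : ¬ Derives T [neg ψ] fal := fun h' => hψ (.raa h')
  obtain ⟨Δ, hΔ, hmem⟩ := exists_isHenkin h₀
  have hψΔ : ψ ∈ Δ := by
    have := h hΔ.model (fun φ hφ v w => ?_) (fun n => Quotient.mk hΔ.setoid (.var n)) id
    · rwa [hΔ.sat_model, subst_var_id] at this
    -- Choosing representatives turns an assignment in the term model into a substitution, so the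
    -- axiom holds by `ax_subst`.
    · have hv : v = fun n => Quotient.mk hΔ.setoid (v n).out := by
        funext n
        exact (Quotient.out_eq _).symm
      rw [hv]
      exact (hΔ.sat_model _ _ _).2 (hΔ.closed (Γ := []) (by simp) (.ax_subst hφ _ _ _))
  exact hΔ.fal_notMem (hΔ.imp_mem_iff.1 (hmem (neg ψ) (by simp)) hψΔ)

end SOA

namespace SOA

open Formula

/-! ### Satisfaction -/

section Sat

variable {M : Struc} {v : ℕ → M.N} {w : ℕ → M.S} {φ ψ : Formula}

instance : Zero M.N := ⟨M.zero⟩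
instance : One M.N := ⟨M.one⟩
instance : Add M.N := ⟨M.add⟩
instance : Mul M.N := ⟨M.mul⟩

@[simp] theorem scons_zero {α : Type} (a : α) (u : ℕ → α) : scons a u 0 = a := rfl
@[simp] theorem scons_succ {α : Type} (a : α) (u : ℕ → α) (n : ℕ) : scons a u (n + 1) = u n := rfl

@[simp] theorem Term.eval_var (n : ℕ) : (Term.var n).eval M v = v n := rfl
@[simp] theorem Term.eval_zero : Term.zero.eval M v = 0 := rfl
@[simp] theorem Term.eval_one : Term.one.eval M v = 1 := rfl
@[simp] theorem Term.eval_add (s t : Term) : (Term.add s t).eval M v = s.eval M v + t.eval M v := rfl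
@[simp] theorem Term.eval_mul (s t : Term) : (Term.mul s t).eval M v = s.eval M v * t.eval M v := rfl

theorem Term.eval_subst (t : Term) (σ : ℕ → Term) :
    (t.subst σ).eval M v = t.eval M fun n => (σ n).eval M v := by
  induction t <;> simp_all [Term.subst, Term.eval] <;> rfl

@[simp] theorem Term.eval_shift (t : Term) (a : M.N) : t.shift.eval M (scons a v) = t.eval M v := by
  simp [Term.shift, Term.eval_subst]

/-- The value of the term `pair i j`. -/
def pairVal (a b : M.N) : M.N := (a + b) * (a + b) + a

@[simp] theorem eval_pair (s t : Term) :
    (pair s t).eval M v = pairVal (s.eval M v) (t.eval M v) := rfl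

namespace Formula

@[simp] theorem sat_eq (s t : Term) : (eq s t).Sat M v w ↔ s.eval M v = t.eval M v := Iff.rfl
@[simp] theorem sat_lt (s t : Term) : (lt s t).Sat M v w ↔ M.lt (s.eval M v) (t.eval M v) := Iff.rfl
@[simp] theorem sat_mem (t : Term) (X : ℕ) : (mem t X).Sat M v w ↔ M.mem (t.eval M v) (w X) := Iff.rfl
@[simp] theorem sat_imp : (imp φ ψ).Sat M v w ↔ (φ.Sat M v w → ψ.Sat M v w) := Iff.rfl
@[simp] theorem sat_allN : (allN φ).Sat M v w ↔ ∀ a, φ.Sat M (scons a v) w := Iff.rfl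
@[simp] theorem sat_allS : (allS φ).Sat M v w ↔ ∀ A, φ.Sat M v (scons A w) := Iff.rfl
@[simp] theorem sat_neg : (neg φ).Sat M v w ↔ ¬ φ.Sat M v w := Iff.rfl

@[simp] theorem sat_or : (or φ ψ).Sat M v w ↔ φ.Sat M v w ∨ ψ.Sat M v w := by
  simp only [or, sat_imp, sat_neg]
  tauto

@[simp] theorem sat_and : (and φ ψ).Sat M v w ↔ φ.Sat M v w ∧ ψ.Sat M v w := by
  simp only [and, sat_imp, sat_neg]
  tauto

@[simp] theorem sat_iff : (iff φ ψ).Sat M v w ↔ (φ.Sat M v w ↔ ψ.Sat M v w) := by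
  simp only [iff, sat_imp, sat_and]
  tauto

@[simp] theorem sat_exN : (exN φ).Sat M v w ↔ ∃ a, φ.Sat M (scons a v) w := by
  simp [exN]

@[simp] theorem sat_exS : (exS φ).Sat M v w ↔ ∃ A, φ.Sat M v (scons A w) := by
  simp [exS]

theorem sat_subst (φ : Formula) (σ : ℕ → Term) (ρ : ℕ → ℕ) (v : ℕ → M.N) (w : ℕ → M.S) :
    (φ.subst σ ρ).Sat M v w ↔ φ.Sat M (fun n => (σ n).eval M v) (fun n => w (ρ n)) := by
  induction φ generalizing σ ρ v w with
  | eq s t => simp [subst, Term.eval_subst]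
  | lt s t => simp [subst, Term.eval_subst]
  | mem t X => simp [subst, Term.eval_subst]
  | fal => exact Iff.rfl
  | imp φ ψ h₁ h₂ => simp [subst, h₁, h₂]
  | allN φ ih =>
    simp only [subst, sat_allN, ih]
    refine forall_congr' fun a => ?_
    have : (fun n => (liftN σ n).eval M (scons a v)) = scons a fun n => (σ n).eval M v := by
      funext n
      cases n <;> simp [liftN]
    rw [this]
  | allS φ ih =>
    simp only [subst, sat_allS, ih]
    refine forall_congr' fun A => ?_
    have : (fun n => scons A w (liftS ρ n)) = scons A fun n => w (ρ n) := by
      funext n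
      cases n <;> rfl
    rw [this]

/-- `∀ n < t, φ`. -/
def ball (t : Term) (φ : Formula) : Formula := allN (imp (lt (.var 0) t.shift) φ)

/-- `∃ n < t, φ`. -/
def bex (t : Term) (φ : Formula) : Formula := exN (and (lt (.var 0) t.shift) φ)

@[simp] theorem sat_ball (t : Term) : (ball t φ).Sat M v w ↔
    ∀ a, M.lt a (t.eval M v) → φ.Sat M (scons a v) w := by
  simp [ball]

@[simp] theorem sat_bex (t : Term) : (bex t φ).Sat M v w ↔
    ∃ a, M.lt a (t.eval M v) ∧ φ.Sat M (scons a v) w := by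
  simp [bex]

namespace IsSigma00

theorem neg (h : IsSigma00 φ) : IsSigma00 (neg φ) := .imp h .fal
theorem and (h : IsSigma00 φ) (h' : IsSigma00 ψ) : IsSigma00 (and φ ψ) := .neg (.imp h (.neg h'))
theorem or (h : IsSigma00 φ) (h' : IsSigma00 ψ) : IsSigma00 (or φ ψ) := .imp (.neg h) h'
theorem le (s t : Term) : IsSigma00 (le s t) := .or (.lt s t) (.eq s t)
theorem ball (t : Term) (h : IsSigma00 φ) : IsSigma00 (ball t φ) := .ballN t h
theorem bex (t : Term) (h : IsSigma00 φ) : IsSigma00 (bex t φ) := .bexN t h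

end IsSigma00

end Formula

end Sat

/-! ### Arithmetic in models of `RCA₀*` -/

/-- Models of `RCA₀*`. -/
class IsRCA0starModel (M : Struc) : Prop where
  sat : ∀ φ, RCA0starAxiom φ → ∀ v w, φ.Sat M v w
  nonempty : Nonempty M.S

namespace IsRCA0starModel

variable {M : Struc} [hM : IsRCA0starModel M]

theorem induction {φ : Formula} (hφ : IsSigma00 φ) (v : ℕ → M.N) (w : ℕ → M.S)
    (h0 : φ.Sat M (scons 0 v) w)
    (hs : ∀ n, φ.Sat M (scons n v) w → φ.Sat M (scons (n + 1) v) w) (n : M.N) :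
    φ.Sat M (scons n v) w := by
  have h := hM.sat _ (.sigma00_induction φ hφ) v w
  simp only [sat_imp, sat_and, sat_allN, instN, sat_subst] at h
  refine h ⟨?_, fun a ha => ?_⟩ n
  · convert h0 using 1
    · funext n
      cases n <;> rfl
    · rfl
  · convert hs a ha using 1
    · funext n
      cases n <;> rfl
    · rfl

/-- Induction for formulas without set variables, with three parameters. -/
theorem induction₃ {φ : Formula} (hφ : IsSigma00 φ) (a b c : M.N) (p : M.N → Prop)
    (hp : ∀ n w, φ.Sat M (scons n (scons a (scons b fun _ => c))) w ↔ p n)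
    (h0 : p 0) (hs : ∀ n, p n → p (n + 1)) (n : M.N) : p n := by
  obtain ⟨A⟩ := hM.nonempty
  have h := induction hφ (scons a (scons b fun _ => c)) (fun _ => A)
  simp only [hp] at h
  exact h h0 hs n

theorem sat_ax {φ : Formula} (h : RCA0starAxiom φ) (a b : M.N) :
    ∃ w, φ.Sat M (scons a fun _ => b) w := by
  obtain ⟨A⟩ := hM.nonempty
  exact ⟨fun _ => A, hM.sat φ h _ _⟩

theorem succ_ne_zero (a : M.N) : a + 1 ≠ 0 := by
  obtain ⟨w, h⟩ := sat_ax .succ_ne_zero a a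
  simpa using h

theorem succ_inj {a b : M.N} (hab : a + 1 = b + 1) : a = b := by
  obtain ⟨w, h⟩ := sat_ax .succ_inj a b
  simp at h
  exact h hab

theorem add_zero (a : M.N) : a + 0 = a := by
  obtain ⟨w, h⟩ := sat_ax .add_zero a a
  simpa using h

theorem add_succ (a b : M.N) : a + (b + 1) = a + b + 1 := by
  obtain ⟨w, h⟩ := sat_ax .add_succ a b
  simpa using h

theorem mul_zero (a : M.N) : a * 0 = 0 := by
  obtain ⟨w, h⟩ := sat_ax .mul_zero a a
  simpa using h

theorem mul_succ (a b : M.N) : a * (b + 1) = a * b + a := by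
  obtain ⟨w, h⟩ := sat_ax .mul_succ a b
  simpa using h

theorem lt_zero (a : M.N) : ¬ M.lt a 0 := by
  obtain ⟨w, h⟩ := sat_ax .not_lt_zero a a
  simpa using h

theorem lt_succ (a b : M.N) : M.lt a (b + 1) ↔ M.lt a b ∨ a = b := by
  obtain ⟨w, h⟩ := sat_ax .lt_succ a b
  simpa using h

open Term in
theorem zero_add (a : M.N) : 0 + a = a :=
  induction₃ (.eq (add zero (var 0)) (var 0)) 0 0 0 (fun n => 0 + n = n) (by simp)
    (add_zero 0) (fun n h => by rw [add_succ, h]) a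

open Term in
theorem succ_add (a b : M.N) : a + 1 + b = a + b + 1 :=
  induction₃ (.eq (add (add (var 1) one) (var 0)) (add (add (var 1) (var 0)) one)) a 0 0
    (fun n => a + 1 + n = a + n + 1) (by simp)
    (by rw [add_zero, add_zero]) (fun n h => by rw [add_succ, h, add_succ]) b

open Term in
theorem add_comm (a b : M.N) : a + b = b + a :=
  induction₃ (.eq (add (var 1) (var 0)) (add (var 0) (var 1))) a 0 0
    (fun n => a + n = n + a) (by simp)
    (by rw [add_zero, zero_add]) (fun n h => by rw [add_succ, h, succ_add]) b

open Term in
theorem add_assoc (a b c : M.N) : a + b + c = a + (b + c) :=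
  induction₃ (.eq (add (add (var 1) (var 2)) (var 0)) (add (var 1) (add (var 2) (var 0)))) a b 0
    (fun n => a + b + n = a + (b + n)) (by simp)
    (by rw [add_zero, add_zero]) (fun n h => by rw [add_succ, h, add_succ, add_succ]) c

open Term in
theorem zero_mul (a : M.N) : 0 * a = 0 :=
  induction₃ (.eq (mul zero (var 0)) zero) 0 0 0 (fun n => 0 * n = 0) (by simp)
    (mul_zero 0) (fun n h => by rw [mul_succ, h, add_zero]) a

open Term in
theorem succ_mul (a b : M.N) : (a + 1) * b = a * b + b :=
  induction₃ (.eq (mul (add (var 1) one) (var 0)) (add (mul (var 1) (var 0)) (var 0))) a 0 0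
    (fun n => (a + 1) * n = a * n + n) (by simp)
    (by rw [mul_zero, mul_zero, add_zero])
    (fun n h => by
      rw [mul_succ, h, mul_succ, add_succ, add_succ, add_assoc (a * n) n, add_comm n a,
        ← add_assoc]) b

open Term in
theorem mul_comm (a b : M.N) : a * b = b * a :=
  induction₃ (.eq (mul (var 1) (var 0)) (mul (var 0) (var 1))) a 0 0
    (fun n => a * n = n * a) (by simp)
    (by rw [mul_zero, zero_mul]) (fun n h => by rw [mul_succ, h, succ_mul]) b

open Term in
theorem mul_add (a b c : M.N) : a * (b + c) = a * b + a * c :=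
  induction₃ (.eq (mul (var 1) (add (var 2) (var 0)))
      (add (mul (var 1) (var 2)) (mul (var 1) (var 0)))) a b 0
    (fun n => a * (b + n) = a * b + a * n) (by simp)
    (by rw [add_zero, mul_zero, add_zero])
    (fun n h => by rw [add_succ, mul_succ, h, mul_succ, add_assoc]) c

open Term in
theorem mul_assoc (a b c : M.N) : a * b * c = a * (b * c) :=
  induction₃ (.eq (mul (mul (var 1) (var 2)) (var 0)) (mul (var 1) (mul (var 2) (var 0)))) a b 0
    (fun n => a * b * n = a * (b * n)) (by simp)
    (by rw [mul_zero, mul_zero, mul_zero])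
    (fun n h => by rw [mul_succ, h, mul_succ, mul_add]) c

theorem mul_one (a : M.N) : a * 1 = a := by
  rw [← zero_add 1, mul_succ, mul_zero, zero_add]

instance : CommSemiring M.N where
  add_assoc := add_assoc
  zero_add := zero_add
  add_zero := add_zero
  add_comm := add_comm
  mul_assoc := mul_assoc
  one_mul a := by rw [mul_comm, mul_one]
  mul_one := mul_one
  left_distrib := mul_add
  right_distrib a b c := by rw [mul_comm, mul_add, mul_comm c a, mul_comm c b]
  zero_mul := zero_mul
  mul_zero := mul_zero
  mul_comm := mul_comm
  nsmul := nsmulRec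

open Term in
theorem add_right_cancel {a b c : M.N} : a + c = b + c → a = b :=
  induction₃ (φ := imp (eq (add (var 1) (var 0)) (add (var 2) (var 0))) (eq (var 1) (var 2)))
    (.imp (.eq _ _) (.eq _ _)) a b 0
    (fun n => a + n = b + n → a = b) (by simp)
    (by simp) (fun n h h' => h (succ_inj (by rwa [← add_succ, ← add_succ]))) c

instance : IsCancelAdd M.N where
  add_left_cancel a b c h := add_right_cancel (c := a) (by simpa [_root_.add_comm] using h)
  add_right_cancel a b c h := add_right_cancel h

open Term in
theorem zero_lt_succ (a : M.N) : M.lt 0 (a + 1) :=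
  induction₃ (.lt zero (add (var 0) one)) 0 0 0 (fun n => M.lt 0 (n + 1)) (by simp)
    ((lt_succ _ _).2 (.inr rfl)) (fun _ h => (lt_succ _ _).2 (.inl h)) a

open Term in
theorem succ_lt_succ {a b : M.N} : M.lt a b → M.lt (a + 1) (b + 1) :=
  induction₃ (φ := imp (lt (var 1) (var 0)) (lt (add (var 1) one) (add (var 0) one)))
    (.imp (.lt _ _) (.lt _ _)) a 0 0 (fun n => M.lt a n → M.lt (a + 1) (n + 1)) (by simp)
    (fun h => (lt_zero _ h).elim)
    (fun n h h' => (lt_succ _ _).2 (((lt_succ _ _).1 h').imp h fun e => by rw [e])) b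

open Term in
-- The bound on `d` keeps the formula `Σ⁰₀`, hence within reach of induction; `lt_iff` then drops
-- it.
theorem exists_of_lt {a b : M.N} : M.lt a b → ∃ d, M.lt d b ∧ b = a + (d + 1) :=
  induction₃ (φ := imp (lt (var 1) (var 0)) (bex (var 0) (eq (var 1) (add (var 2) (add (var 0) one)))))
    (.imp (.lt _ _) (.bex _ (.eq _ _))) a 0 0
    (fun n => M.lt a n → ∃ d, M.lt d n ∧ n = a + (d + 1)) (by simp)
    (fun h => (lt_zero _ h).elim)
    (fun n h h' => by
      rcases (lt_succ _ _).1 h' with h' | rfl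
      · obtain ⟨d, hd, e⟩ := h h'
        refine ⟨d + 1, succ_lt_succ hd, ?_⟩
        rw [add_succ a, ← e]
      · exact ⟨0, zero_lt_succ _, by simp⟩) b

open Term in
theorem lt_add_succ (a d : M.N) : M.lt a (a + (d + 1)) :=
  induction₃ (.lt (var 1) (add (var 1) (add (var 0) one))) a 0 0
    (fun n => M.lt a (a + (n + 1))) (by simp)
    (by rw [zero_add]; exact (lt_succ _ _).2 (.inr rfl))
    (fun n h => by rw [add_succ]; exact (lt_succ _ _).2 (.inl h)) d

theorem lt_iff {a b : M.N} : M.lt a b ↔ ∃ d, b = a + (d + 1) :=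
  ⟨fun h => let ⟨d, _, e⟩ := exists_of_lt h; ⟨d, e⟩, fun ⟨d, e⟩ => e ▸ lt_add_succ a d⟩

theorem lt_irrefl (a : M.N) : ¬ M.lt a a := by
  rw [lt_iff]
  rintro ⟨d, h⟩
  exact succ_ne_zero d (left_eq_add.1 h)

theorem lt_trans {a b c : M.N} (h : M.lt a b) (h' : M.lt b c) : M.lt a c := by
  rw [lt_iff] at *
  obtain ⟨d, rfl⟩ := h
  obtain ⟨e, rfl⟩ := h'
  exact ⟨d + e + 1, by ring⟩

open Term in
theorem eq_zero_or_zero_lt (a : M.N) : a = 0 ∨ M.lt 0 a :=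
  induction₃ (φ := or (eq (var 0) zero) (lt zero (var 0)))
    (.or (.eq _ _) (.lt _ _)) 0 0 0 (fun n => n = 0 ∨ M.lt 0 n) (by simp)
    (.inl rfl) (fun n _ => .inr (zero_lt_succ n)) a

open Term in
theorem lt_trichotomy (a b : M.N) : M.lt a b ∨ a = b ∨ M.lt b a :=
  induction₃ (φ := or (lt (var 1) (var 0)) (or (eq (var 1) (var 0)) (lt (var 0) (var 1))))
    (.or (.lt _ _) (.or (.eq _ _) (.lt _ _))) a 0 0
    (fun n => M.lt a n ∨ a = n ∨ M.lt n a) (by simp)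
    (.inr (eq_zero_or_zero_lt a))
    (fun n h => by
      rcases h with h | rfl | h
      · exact .inl ((lt_succ _ _).2 (.inl h))
      · exact .inl ((lt_succ _ _).2 (.inr rfl))
      · obtain ⟨d, rfl⟩ := lt_iff.1 h
        rcases eq_zero_or_zero_lt d with rfl | hd
        · exact .inr (.inl (by simp))
        · obtain ⟨e, rfl⟩ := lt_iff.1 hd
          exact .inr (.inr (lt_iff.2 ⟨e, by ring⟩))) b

noncomputable instance : LinearOrder M.N where
  le a b := M.lt a b ∨ a = b
  lt := M.lt
  le_refl a := .inr rfl
  le_trans a b c h h' := by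
    rcases h with h | rfl
    · rcases h' with h' | rfl
      exacts [.inl (lt_trans h h'), .inl h]
    · exact h'
  lt_iff_le_not_ge a b := by
    constructor
    · rintro h
      refine ⟨.inl h, ?_⟩
      rintro (h' | rfl)
      exacts [lt_irrefl _ (lt_trans h h'), lt_irrefl _ h]
    · rintro ⟨h | rfl, h'⟩
      exacts [h, (h' (.inr rfl)).elim]
  le_antisymm a b h h' := by
    rcases h with h | rfl
    · rcases h' with h' | rfl
      exacts [(lt_irrefl _ (lt_trans h h')).elim, rfl]
    · rfl
  le_total a b := by
    rcases lt_trichotomy a b with h | h | h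
    exacts [.inl (.inl h), .inl (.inr h), .inr (.inl h)]
  toDecidableLE := Classical.decRel _

@[simp] theorem struc_lt_iff (a b : M.N) : M.lt a b ↔ a < b := Iff.rfl

@[simp] theorem sat_le {v : ℕ → M.N} {w : ℕ → M.S} (s t : Term) :
    (Formula.le s t).Sat M v w ↔ s.eval M v ≤ t.eval M v := by
  simp only [Formula.le, sat_or]
  rfl

theorem lt_succ_iff {a b : M.N} : a < b + 1 ↔ a ≤ b := lt_succ a b

theorem le_add_right (a b : M.N) : a ≤ a + b := by
  rcases eq_zero_or_zero_lt b with rfl | h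
  · simp
  · obtain ⟨d, rfl⟩ := lt_iff.1 h
    exact .inl (lt_iff.2 ⟨d, by ring⟩)

theorem le_pairVal (a b : M.N) : a ≤ pairVal a b := by
  rw [pairVal, _root_.add_comm]
  exact le_add_right _ _

theorem not_add_lt_add_of_pairVal_eq {a b a' b' : M.N} (h : pairVal a b = pairVal a' b') :
    ¬ a + b < a' + b' := by
  intro hlt
  obtain ⟨d, hd⟩ := lt_iff.1 hlt
  rw [pairVal, pairVal, hd] at h
  -- The bracket is the explicit difference of the two codes. It is a successor, yet equality of the
  -- codes would make it zero.
  have : (a + b) * (a + b) + a + ((b + (a + b) + 2 * d * (a + b) + d * d + 2 * d + a') + 1) =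
      (a + b) * (a + b) + a := by
    refine Eq.trans ?_ h.symm
    ring
  exact succ_ne_zero _ (add_eq_left.1 this)

theorem pairVal_inj {a b a' b' : M.N} (h : pairVal a b = pairVal a' b') : a = a' ∧ b = b' := by
  have hs : a + b = a' + b' := le_antisymm (not_lt.1 (not_add_lt_add_of_pairVal_eq h.symm))
    (not_lt.1 (not_add_lt_add_of_pairVal_eq h))
  rw [pairVal, pairVal, hs] at h
  obtain rfl := add_left_cancel h
  exact ⟨rfl, add_left_cancel hs⟩

/-- For a `Σ⁰₀` property both sides of `Δ⁰₁` comprehension can be the same `θ` under a dummy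
quantifier. -/
theorem comprehension {θ : Formula} (hθ : IsSigma00 θ) (v : ℕ → M.N) (w : ℕ → M.S)
    (p : M.N → Prop) (hp : ∀ m n, θ.Sat M (scons m (scons n v)) w ↔ p n) :
    ∃ X, ∀ n, M.mem n X ↔ p n := by
  have h := hM.sat _ (.delta01_comprehension θ θ hθ hθ) v w
  simp only [sat_imp, sat_allN, sat_iff, sat_exN, sat_exS, shiftS, sat_subst] at h
  have hne : Nonempty M.N := ⟨0⟩
  simp only [hp, exists_const, forall_const] at h
  obtain ⟨X, hX⟩ := h
  exact ⟨X, fun n => (hX n).trans ((exists_congr fun m => hp m n).trans (exists_const _))⟩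

/-! ### ECT and minECT in models of `RCA₀*` -/

/-- The set `F` is a function with values below `k`. -/
def IsFunction (F : M.S) (k : M.N) : Prop :=
  (∀ n, M.mem n F → ∃ i j, j < k ∧ n = pairVal i j) ∧
    ∀ i, ∃ j < k, M.mem (pairVal i j) F ∧ ∀ j', M.mem (pairVal i j') F → j' = j

/-- `b` is a bound for the function `F`. -/
def IsBound (F : M.S) (b : M.N) : Prop :=
  ∀ x, b ≤ x → ∃ y, x < y ∧ ∃ c, M.mem (pairVal x c) F ∧ M.mem (pairVal y c) F

theorem sat_isFunction (v : ℕ → M.N) (w : ℕ → M.S) (F k : ℕ) :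
    (isFunction F k).Sat M v w ↔ IsFunction (w F) (v k) := by
  simp [isFunction, IsFunction]

theorem sat_isECTBound (v : ℕ → M.N) (w : ℕ → M.S) (F b : ℕ) :
    (isECTBound F b).Sat M v w ↔ IsBound (w F) (v b) := by
  simp [isECTBound, IsBound]

theorem sat_ECTSentence (v : ℕ → M.N) (w : ℕ → M.S) :
    ECTSentence.Sat M v w ↔ ∀ k F, IsFunction (M := M) F k → ∃ b, IsBound F b := by
  simp [ECTSentence, sat_isFunction, sat_isECTBound]

theorem sat_minECTSentence (v : ℕ → M.N) (w : ℕ → M.S) :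
    minECTSentence.Sat M v w ↔ ∀ k F, IsFunction (M := M) F k →
      ∃ b, IsBound F b ∧ ∀ b' < b, ¬ IsBound F b' := by
  simp [minECTSentence, sat_isFunction, sat_isECTBound]

/-- Every `x` in `[u, b)` sees its colour again at some `y ≤ s`. -/
def IsBoundAt (F : M.S) (k b s u : M.N) : Prop :=
  ∀ x < b, u ≤ x → ∃ y < s + 1, x < y ∧ ∃ c < k, M.mem (pairVal x c) F ∧ M.mem (pairVal y c) F

/-- The formula that defines `IsBoundAt`. -/
def isBoundAtFormula (k b s u : ℕ) : Formula :=
  ball (.var b) (imp (le (.var (u + 1)) (.var 0)) (bex (.add (.var (s + 1)) .one)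
    (and (lt (.var 1) (.var 0)) (bex (.var (k + 2))
      (and (mem (pair (.var 2) (.var 0)) 0) (mem (pair (.var 1) (.var 0)) 0))))))

theorem isSigma00_isBoundAtFormula (k b s u : ℕ) : IsSigma00 (isBoundAtFormula k b s u) :=
  .ball _ (.imp (.le _ _) (.bex _ (.and (.lt _ _) (.bex _ (.and (.mem _ _) (.mem _ _))))))

@[simp] theorem sat_isBoundAtFormula (v : ℕ → M.N) (w : ℕ → M.S) (k b s u : ℕ) :
    (isBoundAtFormula k b s u).Sat M v w ↔ IsBoundAt (w 0) (v k) (v b) (v s) (v u) := by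
  simp [isBoundAtFormula, IsBoundAt]

/-- This makes the stagewise least bounds nonincreasing in `s`. -/
theorem IsBoundAt.mono {F : M.S} {k b s s' u : M.N} (h : IsBoundAt F k b s u) (hs : s ≤ s') :
    IsBoundAt F k b s' u := by
  intro x hx hu
  obtain ⟨y, hy, h⟩ := h x hx hu
  exact ⟨y, lt_succ_iff.2 ((lt_succ_iff.1 hy).trans hs), h⟩

/-- `u` is least with `IsBoundAt F k b s u`. -/
def IsLeastBoundAt (F : M.S) (k b s u : M.N) : Prop :=
  IsBoundAt F k b s u ∧ ∀ u' < u, ¬ IsBoundAt F k b s u'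

theorem IsLeastBoundAt.unique {F : M.S} {k b s u u' : M.N} (h : IsLeastBoundAt F k b s u)
    (h' : IsLeastBoundAt F k b s u') : u = u' :=
  le_antisymm (not_lt.1 fun hl => h.2 _ hl h'.1) (not_lt.1 fun hl => h'.2 _ hl h.1)

theorem exists_isLeastBoundAt (F : M.S) (k b s : M.N) :
    ∃ u, u < b + 1 ∧ IsLeastBoundAt F k b s u := by
  have hb : IsBoundAt F k b s b := fun x hx hx' => (hx.not_ge hx').elim
  suffices h : ∃ u, IsLeastBoundAt F k b s u by
    obtain ⟨u, hu⟩ := h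
    exact ⟨u, lt_succ_iff.2 (not_lt.1 fun hlt => hu.2 b hlt hb), hu⟩
  by_contra! hno
  -- Least number principle: if there is no least `u`, induction shows that nothing below `n`
  -- qualifies, for every `n`; but `b` qualifies vacuously.
  have := induction (M := M) (φ := ball (.var 0) (neg (isBoundAtFormula 2 3 4 0)))
    (.ball _ (.neg (isSigma00_isBoundAtFormula _ _ _ _))) (scons k (scons b fun _ => s)) (fun _ => F)
  simp only [sat_ball, sat_neg, sat_isBoundAtFormula, Term.eval_var, scons_zero, struc_lt_iff] at this
  refine this (fun a ha => (lt_zero a ha).elim) (fun n hn a ha => ?_) (b + 1) b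
    (lt_succ_iff.2 le_rfl) hb
  rcases (lt_succ_iff.1 ha).lt_or_eq with h | rfl
  · exact hn a h
  · exact fun h => hno a ⟨h, hn⟩

/-- The set of all pairs `(s, u)` such that `u` is the least bound for `F` that looks correct at
stage `s`. -/
theorem exists_leastBoundAt_set (F : M.S) (k b : M.N) :
    ∃ G, ∀ n, M.mem n G ↔ ∃ s u, n = pairVal s u ∧ IsLeastBoundAt F k b s u := by
  obtain ⟨G, hG⟩ := comprehension (M := M)
    (θ := bex (.add (.var 1) .one) (bex (.add (.var 3) .one)
      (and (eq (.var 3) (pair (.var 1) (.var 0))) (and (isBoundAtFormula 5 4 1 0)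
        (ball (.var 0) (neg (isBoundAtFormula 6 5 2 0)))))))
    (.bex _ (.bex _ (.and (.eq _ _) (.and (isSigma00_isBoundAtFormula _ _ _ _)
      (.ball _ (.neg (isSigma00_isBoundAtFormula _ _ _ _)))))))
    (scons b fun _ => k) (fun _ => F)
    -- Both quantifiers can be bounded: `s` is at most the code of the pair, and the least `u` is at
    -- most `b`.
    (fun n => ∃ s < n + 1, ∃ u < b + 1, n = pairVal s u ∧ IsLeastBoundAt F k b s u)
    (fun m n => by simp [IsLeastBoundAt])
  refine ⟨G, fun n => (hG n).trans ⟨?_, ?_⟩⟩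
  · rintro ⟨s, _, u, _, h⟩
    exact ⟨s, u, h⟩
  · rintro ⟨s, u, rfl, h⟩
    obtain ⟨u', hu', h'⟩ := exists_isLeastBoundAt F k b s
    obtain rfl := h.unique h'
    exact ⟨s, lt_succ_iff.2 (le_pairVal s u), u, hu', rfl, h⟩

theorem eventually_const {G : M.S} {b u : M.N} (h0 : M.mem (pairVal b u) G)
    (hs : ∀ s, b ≤ s → M.mem (pairVal s u) G → M.mem (pairVal (s + 1) u) G) (s : M.N)
    (hbs : b ≤ s) : M.mem (pairVal s u) G := by
  have := induction (M := M) (φ := imp (le (.var 1) (.var 0)) (mem (pair (.var 0) (.var 2)) 0))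
    (.imp (.le _ _) (.mem _ _)) (scons b fun _ => u) (fun _ => G)
  simp only [sat_imp, sat_le, sat_mem, eval_pair, Term.eval_var, scons_zero] at this
  refine this (fun hb => ?_) (fun n hn hb => ?_) s hbs
  · obtain hb | hb := hb
    · exact (lt_zero _ hb).elim
    · change b = 0 at hb
      exact hb ▸ h0
  · rcases hb.lt_or_eq with hb | hb
    · exact hs n (lt_succ_iff.1 hb) (hn (lt_succ_iff.1 hb))
    · change b = n + 1 at hb
      exact hb ▸ h0

/-- Stability of the limit `u` gives both halves: points of `[u, b)` have repeated by stage `t`, and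
a smaller bound would make the predecessor of `u` qualify at a later stage. Only that single point
needs a witness, so no collection principle is involved. -/
theorem exists_least_bound (hect : ∀ k F, IsFunction (M := M) F k → ∃ b, IsBound F b)
    (k : M.N) (F : M.S) (hF : IsFunction F k) :
    ∃ b, IsBound F b ∧ ∀ b' < b, ¬ IsBound F b' := by
  obtain ⟨b, hb⟩ := hect k F hF
  obtain ⟨G, hG⟩ := exists_leastBoundAt_set F k b
  have hGmem : ∀ s u, M.mem (pairVal s u) G ↔ IsLeastBoundAt F k b s u := by
    intro s u
    rw [hG]
    constructor
    · rintro ⟨s', u', he, h⟩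
      obtain ⟨rfl, rfl⟩ := pairVal_inj he
      exact h
    · exact fun h => ⟨s, u, rfl, h⟩
  have hGfun : IsFunction G (b + 1) := by
    refine ⟨fun n hn => ?_, fun s => ?_⟩
    · obtain ⟨s, u, rfl, h⟩ := (hG n).1 hn
      obtain ⟨u', hu', h'⟩ := exists_isLeastBoundAt F k b s
      obtain rfl := h.unique h'
      exact ⟨s, u, hu', rfl⟩
    · obtain ⟨u, hu, h⟩ := exists_isLeastBoundAt F k b s
      exact ⟨u, hu, (hGmem s u).2 h, fun u' hu' => ((hGmem s u').1 hu').unique h⟩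
  obtain ⟨t, ht⟩ := hect (b + 1) G hGfun
  obtain ⟨u, hub, hu⟩ := exists_isLeastBoundAt F k b t
  have hconst : ∀ s, t ≤ s → IsLeastBoundAt F k b s u := by
    intro s hs
    refine (hGmem s u).1 (eventually_const ((hGmem t u).2 hu) (fun s hs h => ?_) s hs)
    -- The value at `s` recurs at some `y > s`; by monotonicity the value at `s + 1` is squeezed
    -- between two equal values.
    obtain ⟨y, hy, c, hc, hc'⟩ := ht s hs
    rw [hGmem] at *
    obtain rfl := hc.unique h
    obtain ⟨c', -, h'⟩ := exists_isLeastBoundAt F k b (s + 1)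
    have hsy : s + 1 ≤ y := not_lt.1 fun hlt => (lt_succ_iff.1 hlt).not_gt hy
    have h₁ : c ≤ c' := not_lt.1 fun hlt => hc'.2 _ hlt (h'.1.mono hsy)
    have h₂ : c' ≤ c := not_lt.1 fun hlt => h'.2 _ hlt (h.1.mono (lt_succ_iff.2 le_rfl).le)
    exact le_antisymm h₁ h₂ ▸ h'
  refine ⟨u, fun x hx => ?_, fun b' hb' hbound => ?_⟩
  · rcases lt_or_ge x b with hxb | hxb
    · obtain ⟨y, -, hxy, c, -, h⟩ := hu.1 x hxb hx
      exact ⟨y, hxy, c, h⟩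
    · exact hb x hxb
  · obtain ⟨d, rfl⟩ := lt_iff.1 hb'
    -- `b' + d` is the predecessor of the limit value. At stage `max t y` its colour has repeated,
    -- and so has that of every later point below `b`.
    obtain ⟨y, hy, c, hc, hc'⟩ := hbound (b' + d) (le_add_right _ _)
    have hlt : b' + d < b' + (d + 1) := by
      rw [← _root_.add_assoc]
      exact lt_succ_iff.2 le_rfl
    refine (hconst (max t y) (le_max_left _ _)).2 (b' + d) hlt fun x hxb hx => ?_
    rcases hx.lt_or_eq with hx | rfl
    · refine (hconst (max t y) (le_max_left _ _)).1 x hxb (not_lt.1 fun hx' => ?_)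
      rw [← _root_.add_assoc] at hx'
      exact (lt_succ_iff.1 hx').not_gt hx
    · obtain ⟨j, hj, -, hj'⟩ := hF.2 (b' + d)
      exact ⟨y, lt_succ_iff.2 (le_max_right _ _), hy, c, hj' c hc ▸ hj, hc, hc'⟩

end IsRCA0starModel

theorem proves_ECT_iff_minECT : Proves RCA0star (iff ECTSentence minECTSentence) := by
  refine proves_of_models fun M h v w => ?_
  have : IsRCA0starModel M := ⟨fun φ hφ => h φ hφ, ⟨w 0⟩⟩
  rw [sat_iff, IsRCA0starModel.sat_ECTSentence, IsRCA0starModel.sat_minECTSentence]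
  refine ⟨IsRCA0starModel.exists_least_bound, fun hmin k F hF => ?_⟩
  obtain ⟨b, hb, -⟩ := hmin k F hF
  exact ⟨b, hb⟩

end SOA

theorem mainTheorem9 :
    WeihrauchLT ECT minECT ∧
      SOA.Proves SOA.RCA0star (SOA.Formula.iff SOA.ECTSentence SOA.minECTSentence) :=
  ⟨⟨weihrauchLE_ECT_minECT, not_weihrauchLE_minECT_ECT⟩, SOA.proves_ECT_iff_minECT⟩
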